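/- There is an algorithm which, given any integer $n\ge 1$ and any non-realizable interval sequence $\mathcal S=([a_1,b_1],\ldots,[a_n,b_n])$ of length $n$ (integers with $0\le a_i\le b_i\le n-1$ for all $i$), outputs in $O(n\log n)$ time a graphic sequence $D=(d_1,\ldots,d_n)$ that minimizes, among all graphic sequences of length $n$, the deviation $$\delta(D,\mathcal S)=\sum_{i=1}^n\max\{0,d_i-b_i\}+\sum_{i=1}^n\max\{0,a_i-d_i\}.$$ Here a sequence of $n$ non-negative integers is graphic if it is the degree sequence of a simple graph on $n$ vertices, $\mathcal S$ is realizable if some graphic sequence $D$ satisfies $a_i\le d_i\le b_i$ for all $i$, and time is counted on a random access machine with words of $O(\log n)$ bits, each basic operation on words costing one unit. -/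

import Mathlib

/-! ## Graphic sequences, interval sequences, deviation -/

/-- A length `n` sequence of non-negative integers is graphic if it is the degree sequence of a
simple graph on `n` vertices. -/
def IsGraphic {n : ℕ} (d : Fin n → ℕ) : Prop :=
  ∃ (G : SimpleGraph (Fin n)) (_ : DecidableRel G.Adj), ∀ i, G.degree i = d i

/-- A length `n` interval sequence `([a₁,b₁],…,[aₙ,bₙ])` with `0 ≤ aᵢ ≤ bᵢ ≤ n - 1`. -/
structure IntervalSeq (n : ℕ) where
  /-- the lower ends `aᵢ` -/
  lo : Fin n → ℕ
  /-- the upper ends `bᵢ` -/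
  hi : Fin n → ℕ
  lo_le_hi : ∀ i, lo i ≤ hi i
  hi_lt : ∀ i, hi i < n

namespace IntervalSeq

variable {n : ℕ}

/-- Some graphic sequence `d` satisfies `aᵢ ≤ dᵢ ≤ bᵢ` for every `i`. -/
def Realizable (S : IntervalSeq n) : Prop :=
  ∃ d : Fin n → ℕ, IsGraphic d ∧ ∀ i, S.lo i ≤ d i ∧ d i ≤ S.hi i

/-- The upper deviation `∑ max {0, dᵢ - bᵢ}` (subtraction of naturals is truncated at `0`). -/
def upperDeviation (S : IntervalSeq n) (d : Fin n → ℕ) : ℕ := ∑ i, (d i - S.hi i)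

/-- The lower deviation `∑ max {0, aᵢ - dᵢ}` (subtraction of naturals is truncated at `0`). -/
def lowerDeviation (S : IntervalSeq n) (d : Fin n → ℕ) : ℕ := ∑ i, (S.lo i - d i)

/-- The (`L₁`-)deviation of `d` with respect to `S`. -/
def deviation (S : IntervalSeq n) (d : Fin n → ℕ) : ℕ :=
  S.upperDeviation d + S.lowerDeviation d

/-- `d` is graphic and has minimum deviation among all graphic sequences of length `n`. -/
def IsMinDeviation (S : IntervalSeq n) (d : Fin n → ℕ) : Prop :=
  IsGraphic d ∧ ∀ d' : Fin n → ℕ, IsGraphic d' → S.deviation d ≤ S.deviation d'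

end IntervalSeq

/-! ## A word RAM

The machine has registers and random access arrays, numbered by `ℕ`; a program is a finite
piece of syntax, so it names only finitely many of them, and array indices are computed at run
time. Every value that arises must be below a word bound `W`; a computation in which some value
reaches `W` is stuck. Each constant, register access, array access, arithmetic operation,
comparison, assignment and test costs one time unit. -/

namespace Ram

/-- The unit-cost operations on words. -/
inductive Op where
  | add | sub | mul | div | mod | lt | eq

/-- Subtraction is truncated at `0`, division rounds down, comparisons return `1` or `0`. -/
def Op.eval : Op → ℕ → ℕ → ℕ
  | .add, x, y => x + y
  | .sub, x, y => x - y
  | .mul, x, y => x * y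
  | .div, x, y => x / y
  | .mod, x, y => x % y
  | .lt, x, y => if x < y then 1 else 0
  | .eq, x, y => if x = y then 1 else 0

/-- Contents of the registers and of the arrays. -/
structure State where
  /-- `reg x` is the content of register `x` -/
  reg : ℕ → ℕ
  /-- `arr a j` is the content of cell `j` of array `a` -/
  arr : ℕ → ℕ → ℕ

/-- Write `v` into register `x`. -/
def State.setReg (σ : State) (x v : ℕ) : State :=
  { σ with reg := Function.update σ.reg x v }

/-- Write `v` into cell `j` of array `a`. -/
def State.setArr (σ : State) (a j v : ℕ) : State :=
  { σ with arr := Function.update σ.arr a (Function.update (σ.arr a) j v) }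

/-- Expressions: constants, registers, array cells with a computed index, operations. -/
inductive Expr where
  | const (k : ℕ)
  | reg (x : ℕ)
  | get (a : ℕ) (j : Expr)
  | op (o : Op) (e₁ e₂ : Expr)

/-- The value of an expression. -/
def Expr.val (σ : State) : Expr → ℕ
  | .const k => k
  | .reg x => σ.reg x
  | .get a j => σ.arr a (j.val σ)
  | .op o e₁ e₂ => o.eval (e₁.val σ) (e₂.val σ)

/-- The time for evaluating an expression: the number of its nodes. -/
def Expr.cost : Expr → ℕ
  | .const _ => 1
  | .reg _ => 1
  | .get _ j => j.cost + 1
  | .op _ e₁ e₂ => e₁.cost + e₂.cost + 1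

/-- All values that arise in the evaluation, array indices included, are below `W`. -/
def Expr.Fits (W : ℕ) (σ : State) : Expr → Prop
  | .const k => k < W
  | .reg x => σ.reg x < W
  | .get a j => j.Fits W σ ∧ σ.arr a (j.val σ) < W
  | .op o e₁ e₂ => e₁.Fits W σ ∧ e₂.Fits W σ ∧ o.eval (e₁.val σ) (e₂.val σ) < W

/-- Programs. -/
inductive Cmd where
  | skip
  | assign (x : ℕ) (e : Expr)
  | store (a : ℕ) (j e : Expr)
  | seq (p q : Cmd)
  | cond (e : Expr) (p q : Cmd)
  | loop (e : Expr) (p : Cmd)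

/-- `Exec W p σ t σ'`: on a machine with word bound `W`, program `p` started in state `σ` halts
in state `σ'` after exactly `t` time units, without overflow. A test `e` succeeds if its value is
not `0`; `loop e p` repeats `p` while the test `e` succeeds. -/
inductive Exec (W : ℕ) : Cmd → State → ℕ → State → Prop
  | skip (σ : State) : Exec W .skip σ 1 σ
  | assign (σ : State) (x : ℕ) (e : Expr) (he : e.Fits W σ) :
      Exec W (.assign x e) σ (e.cost + 1) (σ.setReg x (e.val σ))
  | store (σ : State) (a : ℕ) (j e : Expr) (hj : j.Fits W σ) (he : e.Fits W σ) :
      Exec W (.store a j e) σ (j.cost + e.cost + 1) (σ.setArr a (j.val σ) (e.val σ))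
  | seq {p q : Cmd} {σ σ₁ σ₂ : State} {t₁ t₂ : ℕ}
      (hp : Exec W p σ t₁ σ₁) (hq : Exec W q σ₁ t₂ σ₂) :
      Exec W (.seq p q) σ (t₁ + t₂) σ₂
  | condTrue {e : Expr} {p q : Cmd} {σ σ₁ : State} {t : ℕ}
      (he : e.Fits W σ) (h : e.val σ ≠ 0) (hp : Exec W p σ t σ₁) :
      Exec W (.cond e p q) σ (e.cost + 1 + t) σ₁
  | condFalse {e : Expr} {p q : Cmd} {σ σ₁ : State} {t : ℕ}
      (he : e.Fits W σ) (h : e.val σ = 0) (hq : Exec W q σ t σ₁) :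
      Exec W (.cond e p q) σ (e.cost + 1 + t) σ₁
  | loopDone {e : Expr} {p : Cmd} {σ : State}
      (he : e.Fits W σ) (h : e.val σ = 0) :
      Exec W (.loop e p) σ (e.cost + 1) σ
  | loopStep {e : Expr} {p : Cmd} {σ σ₁ σ₂ : State} {t₁ t₂ : ℕ}
      (he : e.Fits W σ) (h : e.val σ ≠ 0)
      (hp : Exec W p σ t₁ σ₁) (hl : Exec W (.loop e p) σ₁ t₂ σ₂) :
      Exec W (.loop e p) σ (e.cost + 1 + t₁ + t₂) σ₂

/-- The cells of an array that holds a sequence of length `n`, followed by zeros. -/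
def seqCells {n : ℕ} (d : Fin n → ℕ) (j : ℕ) : ℕ :=
  if h : j < n then d ⟨j, h⟩ else 0

/-- The initial state on input `S`: register `0` holds `n`, array `0` holds the lower ends,
array `1` holds the upper ends, and everything else is `0`. -/
def inputState {n : ℕ} (S : IntervalSeq n) : State where
  reg x := if x = 0 then n else 0
  arr a j := if a = 0 then seqCells S.lo j else if a = 1 then seqCells S.hi j else 0

/-- The output of length `n`: the first `n` cells of array `2`. -/
def output (n : ℕ) (σ : State) : Fin n → ℕ := fun i => σ.arr 2 i

end Ram

open Finset

set_option linter.unusedSimpArgs false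

/-! A graphic sequence x satisfies the Erdős–Gallai inequality at every set A, with k = #A.
Replacing x by the lower ends on A and by the upper ends off A costs at most the deviation of x. So
every A bounds the deviation from below by ∑_A lo + k - k² - ∑_{Aᶜ} min(k, hi) (`le_deviation`). The
proof builds a sequence that attains one of these bounds and then repairs its parity.

Indices whose lower end exceeds `level` are high; every other index takes min(hi, level). The high
indices count as a clique and are served in decreasing order of their lower ends. Position k adds
one unit of capacity for each index that is not high and has an upper end above k, and unused
capacity is carried on. The resulting `greedy` sequence satisfies all Erdős–Gallai inequalities
(`egAt_greedy`). The positions before the last one with residual zero form a tight set whose bound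
is attained (`deviation_greedy`).

If the greedy sum is even, the Erdős–Gallai theorem finishes the proof. If it is odd, every
Erdős–Gallai tight set lies among the first `lastTight` positions and has at most that size
(`lt_of_egTight`, `card_le_lastTight`). Hence an index beyond them with lo < hi and hi > `lastTight`
can be moved by one inside its interval. If no such index exists, attaining the bound determines the
parity of the sum (`even_sum_add`). The optimum is then one larger, and lowering some entry above
`lastTight` reaches it.

All data lie below n, so counting sort and a fixed number of linear passes compute this with words
that hold about n². The running time is in fact linear. -/

/-- The Erdős–Gallai inequality for a set `A` of vertices. -/
def EGAt {V : Type*} [Fintype V] [DecidableEq V] (d : V → ℕ) (A : Finset V) : Prop :=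
  ∑ i ∈ A, d i + #A ≤ #A * #A + ∑ i ∈ Aᶜ, min #A (d i)

/-- The Erdős–Gallai inequality holds with equality for `A`. -/
def EGTight {V : Type*} [Fintype V] [DecidableEq V] (d : V → ℕ) (A : Finset V) : Prop :=
  ∑ i ∈ A, d i + #A = #A * #A + ∑ i ∈ Aᶜ, min #A (d i)

theorem sum_update_add {V : Type*} [DecidableEq V] {i : V} (d : V → ℕ) (v : ℕ) {A : Finset V} (hi : i ∈ A) (g : V → ℕ → ℕ) :
    ∑ j ∈ A, g j (Function.update d i v j) + g i (d i) = ∑ j ∈ A, g j (d j) + g i v := by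
  rw [← add_sum_erase _ _ hi, ← add_sum_erase A (fun j => g j (d j)) hi]
  have : ∑ j ∈ A.erase i, g j (Function.update d i v j) = ∑ j ∈ A.erase i, g j (d j) :=
    sum_congr rfl fun j hj => by rw [Function.update_of_ne (ne_of_mem_erase hj)]
  rw [this]; simp; omega

theorem sum_update_notMem {V : Type*} [DecidableEq V] {i : V} (d : V → ℕ) (v : ℕ) {A : Finset V} (hi : i ∉ A)
    (g : V → ℕ → ℕ) :
    ∑ j ∈ A, g j (Function.update d i v j) = ∑ j ∈ A, g j (d j) :=
  sum_congr rfl fun j hj => by rw [Function.update_of_ne (by rintro rfl; exact hi hj)]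

/-! ### Erdős–Gallai inequalities: necessity, and changes of a single entry -/

section ErdosGallai

variable {V : Type*} [Fintype V] [DecidableEq V]

/-- Neighbours are split into those inside and outside A. Inside, each vertex of A has at most #A -
1; the edges leaving A are counted from their outer ends. -/
theorem SimpleGraph.egAt_degree (G : SimpleGraph V) [DecidableRel G.Adj] (A : Finset V) :
    EGAt (fun i => G.degree i) A := by
  have h1 : ∀ i, G.degree i = #{j ∈ A | G.Adj i j} + #{j ∈ Aᶜ | G.Adj i j} := by
    intro i
    rw [← G.card_neighborFinset_eq_degree, G.neighborFinset_eq_filter, ← card_union_of_disjoint,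
      ← filter_union, union_compl]
    exact disjoint_filter_filter disjoint_compl_right
  have h2 : ∑ i ∈ A, #{j ∈ A | G.Adj i j} + #A ≤ #A * #A := by
    rw [card_eq_sum_ones A, ← sum_add_distrib, ← card_eq_sum_ones, ← smul_eq_mul]
    apply sum_le_card_nsmul
    intro i hi
    have : {j ∈ A | G.Adj i j} ⊂ A :=
      filter_ssubset.2 ⟨i, hi, G.irrefl⟩
    exact card_lt_card this
  have h3 : ∑ i ∈ A, #{j ∈ Aᶜ | G.Adj i j} = ∑ j ∈ Aᶜ, #{i ∈ A | G.Adj i j} :=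
    sum_card_bipartiteAbove_eq_sum_card_bipartiteBelow G.Adj
  have h4 : ∑ j ∈ Aᶜ, #{i ∈ A | G.Adj i j} ≤ ∑ j ∈ Aᶜ, min #A (G.degree j) := by
    refine sum_le_sum fun j _ => le_min (card_filter_le _ _) ?_
    rw [← G.card_neighborFinset_eq_degree]
    refine card_le_card fun i hi => ?_
    simpa using (mem_filter.1 hi).2.symm
  unfold EGAt
  simp_rw [h1 , sum_add_distrib]
  simp_rw [h1] at h4
  omega

/-- Raising one entry preserves the Erdős–Gallai inequalities if no tight set contains it. -/
theorem EGAt.raise {d : V → ℕ} (h : ∀ A, EGAt d A) {i : V}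
    (hi : ∀ A, i ∈ A → ¬ EGTight d A) (A : Finset V) :
    EGAt (Function.update d i (d i + 1)) A := by
  have hA := h A
  by_cases hm : i ∈ A
  · have ht := hi A hm
    have h1 := sum_update_add d (d i + 1) hm (fun _ x => x)
    have h2 := sum_update_notMem d (d i + 1) (A := Aᶜ) (by simpa using hm) (fun _ x => min #A x)
    simp only [EGAt, EGTight] at *
    omega
  · have h1 := sum_update_notMem d (d i + 1) hm (fun _ x => x)
    have h2 := sum_update_add d (d i + 1) (A := Aᶜ) (by simpa using hm) (fun _ x => min #A x)
    simp only [EGAt, EGTight] at *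
    omega

/-- Lowering one entry preserves the Erdős–Gallai inequalities if no tight set of at least this
size avoids it. -/
theorem EGAt.lower {d : V → ℕ} (h : ∀ A, EGAt d A) {i : V}
    (hi : ∀ A, i ∉ A → d i ≤ #A → ¬ EGTight d A) (A : Finset V) :
    EGAt (Function.update d i (d i - 1)) A := by
  have hA := h A
  by_cases hm : i ∈ A
  · have h1 := sum_update_add d (d i - 1) hm (fun _ x => x)
    have h2 := sum_update_notMem d (d i - 1) (A := Aᶜ) (by simpa using hm) (fun _ x => min #A x)
    simp only [EGAt, EGTight] at *
    omega
  · have ht := hi A hm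
    have h1 := sum_update_notMem d (d i - 1) hm (fun _ x => x)
    have h2 := sum_update_add d (d i - 1) (A := Aᶜ) (by simpa using hm) (fun _ x => min #A x)
    simp only [EGAt, EGTight] at *
    omega

/-- If all entries outside of a tight set are at most its size, then the sum is even. -/
theorem EGTight.even_sum {d : V → ℕ} {A : Finset V} (h : EGTight d A)
    (hA : ∀ i ∉ A, d i ≤ #A) : Even (∑ i, d i) := by
  have h1 : ∑ i ∈ Aᶜ, min #A (d i) = ∑ i ∈ Aᶜ, d i :=
    sum_congr rfl fun i hi => min_eq_right (hA i (by simpa using hi))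
  have h2 := sum_add_sum_compl A d
  have h3 : Even (#A * #A + #A) := by rw [← Nat.mul_succ]; exact Nat.even_mul_succ_self _
  unfold EGTight at h
  rw [Nat.even_iff] at *
  omega

end ErdosGallai
-- Sufficiency of the Erdős–Gallai inequalities
section
variable {V : Type*} [Fintype V] [DecidableEq V]

theorem SimpleGraph.degree_eq_add_of_adj_iff {G G' : SimpleGraph V} [DecidableRel G.Adj]
    [DecidableRel G'.Adj] {u v : V} (huv : u ≠ v) (hn : ¬ G.Adj u v)
    (h : ∀ x y, G'.Adj x y ↔ G.Adj x y ∨ (x = u ∧ y = v) ∨ (x = v ∧ y = u)) (w : V) :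
    G'.degree w = G.degree w + (if w = u then 1 else 0) + (if w = v then 1 else 0) := by
  rw [← G.card_neighborFinset_eq_degree, ← G'.card_neighborFinset_eq_degree]
  have hn' : ¬ G.Adj v u := fun h => hn h.symm
  by_cases h1 : w = u
  · subst h1
    have : G'.neighborFinset w = insert v (G.neighborFinset w) := by
      ext x; simp [h, huv]; tauto
    rw [this, card_insert_of_notMem (by simpa using hn)]
    simp [huv]
  by_cases h2 : w = v
  · subst h2
    have : G'.neighborFinset w = insert u (G.neighborFinset w) := by
      ext x; simp [h, huv.symm]; tauto
    rw [this, card_insert_of_notMem (by simpa using hn')]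
    simp [huv.symm]
  · have : G'.neighborFinset w = G.neighborFinset w := by
      ext x; simp [h, h1, h2]
    simp [this, h1, h2]

theorem SimpleGraph.exists_add_edge (G : SimpleGraph V) [DecidableRel G.Adj] {u v : V}
    (huv : u ≠ v) (hn : ¬ G.Adj u v) :
    ∃ (G' : SimpleGraph V) (_ : DecidableRel G'.Adj), ∀ w,
      G'.degree w = G.degree w + (if w = u then 1 else 0) + (if w = v then 1 else 0) := by
  classical
  refine ⟨G ⊔ SimpleGraph.edge u v, Classical.decRel _,
    @SimpleGraph.degree_eq_add_of_adj_iff _ _ _ _ _ _ (Classical.decRel _) u v huv hn ?_⟩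
  intro x y
  simp only [SimpleGraph.sup_adj, SimpleGraph.edge_adj]
  constructor
  · tauto
  · rintro (h | ⟨rfl, rfl⟩ | ⟨rfl, rfl⟩)
    · tauto
    · simp [huv]
    · simp [huv.symm]

/-- The edge vw is replaced by iv and jw, so v and w keep their degrees. -/
theorem SimpleGraph.exists_switch (G : SimpleGraph V) [DecidableRel G.Adj] {i j v w : V}
    (hij : i ≠ j) (hvi : v ≠ i) (hwj : w ≠ j) (hvw : G.Adj v w) (hiv : ¬ G.Adj i v)
    (hjw : ¬ G.Adj j w) :
    ∃ (G' : SimpleGraph V) (_ : DecidableRel G'.Adj), ∀ x,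
      G'.degree x = G.degree x + (if x = i then 1 else 0) + (if x = j then 1 else 0) := by
  classical
  set G₁ := G.deleteEdges {s(v, w)} with hG₁
  have d1 : DecidableRel G₁.Adj := Classical.decRel _
  have hne : v ≠ w := hvw.ne
  have a1 : ∀ x y, G₁.Adj x y ↔ G.Adj x y ∧ s(x, y) ≠ s(v, w) := by
    intro x y; simp [hG₁]
  have e1 := SimpleGraph.degree_eq_add_of_adj_iff (G := G₁) (G' := G) hne (by simp [a1]) (by
    intro x y; rw [a1]
    by_cases h : s(x, y) = s(v, w)
    · simp only [h, ne_eq, not_true, and_false, false_or]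
      rw [Sym2.eq_iff] at h
      constructor
      · tauto
      · rintro (⟨rfl, rfl⟩ | ⟨rfl, rfl⟩)
        · exact hvw
        · exact hvw.symm
    · have h' := h
      rw [Sym2.eq_iff] at h'
      tauto)
  obtain ⟨G₂, d2, e2⟩ : ∃ (G' : SimpleGraph V) (_ : DecidableRel G'.Adj),
      (∀ x, G'.degree x = G₁.degree x + (if x = i then 1 else 0) + (if x = v then 1 else 0)) ∧
      ¬ G'.Adj j w := by
    refine ⟨G₁ ⊔ SimpleGraph.edge i v, Classical.decRel _,
      @SimpleGraph.degree_eq_add_of_adj_iff _ _ _ _ _ _ (Classical.decRel _) i v hvi.symm ?_ ?_, ?_⟩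
    · rw [a1]; tauto
    · intro x y
      simp only [SimpleGraph.sup_adj, SimpleGraph.edge_adj]
      constructor
      · tauto
      · rintro (h | ⟨rfl, rfl⟩ | ⟨rfl, rfl⟩)
        · tauto
        · simp [hvi.symm]
        · simp [hvi]
    · simp only [SimpleGraph.sup_adj, SimpleGraph.edge_adj, a1]
      rintro (⟨h, -⟩ | ⟨⟨rfl, rfl⟩ | ⟨rfl, rfl⟩, -⟩)
      · exact hjw h
      · exact hij rfl
      · exact hiv hvw.symm
  obtain ⟨G₃, d3, e3⟩ := G₂.exists_add_edge hwj.symm e2.2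
  refine ⟨G₃, d3, fun x => ?_⟩
  rw [e3, e2.1, e1]
  omega

/-- If A contains i or j, the left side drops at least as much as the right. The critical sets avoid
both, and for them slack has to be found. -/
theorem EGAt.lower_pair {d : V → ℕ} (h : ∀ A, EGAt d A) (hs : Even (∑ i, d i)) {i j : V}
    (hij : i ≠ j) (hi : ∀ x, d x ≤ d i) (hj : 0 < d j) (A : Finset V) :
    EGAt (Function.update (Function.update d i (d i - 1)) j (d j - 1)) A := by
  have hpi : 0 < d i := hj.trans_le (hi j)
  have hji := hi j
  have hA := h A
  have u1 : Function.update d i (d i - 1) j = d j := Function.update_of_ne hij.symm _ _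
  have s1 := sum_update_add (i := j) (Function.update d i (d i - 1)) (d j - 1) (A := A) (g := fun _ x => x)
  have s2 := sum_update_notMem (i := j) (Function.update d i (d i - 1)) (d j - 1) (A := A) (g := fun _ x => x)
  have s3 := sum_update_add (i := j) (Function.update d i (d i - 1)) (d j - 1) (A := Aᶜ) (g := fun _ x => min #A x)
  have s4 := sum_update_notMem (i := j) (Function.update d i (d i - 1)) (d j - 1) (A := Aᶜ) (g := fun _ x => min #A x)
  have t1 := sum_update_add d (d i - 1) (A := A) (i := i) (g := fun _ x => x)
  have t2 := sum_update_notMem d (d i - 1) (A := A) (i := i) (g := fun _ x => x)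
  have t3 := sum_update_add d (d i - 1) (A := Aᶜ) (i := i) (g := fun _ x => min #A x)
  have t4 := sum_update_notMem d (d i - 1) (A := Aᶜ) (i := i) (g := fun _ x => min #A x)
  rw [u1] at s1 s3
  unfold EGAt at *
  simp only [mem_compl] at *
  by_cases hiA : i ∈ A
  · by_cases hjA : j ∈ A
    · simp only [hiA, hjA, not_true_eq_false, not_false_eq_true, forall_const] at *
      omega
    · simp only [hiA, hjA, not_true_eq_false, not_false_eq_true, forall_const] at *
      omega
  by_cases hjA : j ∈ A
  · simp only [hiA, hjA, not_true_eq_false, not_false_eq_true, forall_const] at *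
    omega
  simp only [hiA, hjA, not_true_eq_false, not_false_eq_true, forall_const] at s1 s2 s3 s4 t1 t2 t3 t4
  -- Since d i ≥ d j > #A, both lowered entries are still at least #A and no minimum changes.
  by_cases hjk : #A < d j
  · omega
  have hP : ∑ x ∈ A, d x ≤ #A * d i := by
    rw [← smul_eq_mul]; exact sum_le_card_nsmul _ _ _ fun x _ => hi x
  have hQ : ∑ x ∈ Aᶜ, min #A (d x) =
      min #A (d i) + (min #A (d j) + ∑ x ∈ (Aᶜ.erase i).erase j, min #A (d x)) := by
    rw [add_sum_erase _ (fun x => min #A (d x)) (by simp [hij.symm, hjA]),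
      add_sum_erase _ (fun x => min #A (d x)) (by simp [hiA])]
  set k := #A with hk
  by_cases hik : d i ≤ k
  -- Both minima drop, so slack two is needed. For d i < k it follows from ∑_A d ≤ k · d i; for d i
  -- = k the slack is positive, and even by parity of the sum.
  · suffices ∑ x ∈ A, d x + k + 2 ≤ k * k + ∑ x ∈ Aᶜ, min k (d x) by omega
    rcases hik.lt_or_eq with hlt | heq
    · have : k * d i + k ≤ k * k := by nlinarith
      omega
    · have h1 : ∑ x ∈ Aᶜ, min k (d x) = ∑ x ∈ Aᶜ, d x :=
        sum_congr rfl fun x _ => min_eq_right ((hi x).trans hik)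
      have h2 := sum_add_sum_compl A d
      have h3 : Even (k * k + k) := by rw [← Nat.mul_succ]; exact Nat.even_mul_succ_self _
      rw [Nat.even_iff] at *
      rw [heq] at hP
      omega
  · push Not at hik hjk
    -- Only the minimum at j drops. If A were tight, the inequality for A ∪ {i} would give d i ≤ k +
    -- q, with q the number of other outside entries above k. Tightness yields ∑_A d ≥ k² + kq + d j
    -- > k · d i, against the maximality of d i.
    suffices ∑ x ∈ A, d x + k ≠ k * k + ∑ x ∈ Aᶜ, min k (d x) by omega
    intro ht
    have hB := h (insert i A)
    rw [sum_insert hiA, card_insert_of_notMem hiA, compl_insert, ← hk] at hB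
    have h4 : ∑ x ∈ Aᶜ.erase i, min (k + 1) (d x) =
        ∑ x ∈ Aᶜ.erase i, min k (d x) + #{x ∈ Aᶜ.erase i | k + 1 ≤ d x} := by
      rw [card_filter, ← sum_add_distrib]
      refine sum_congr rfl fun x _ => ?_
      split_ifs <;> omega
    have h5 : ∑ x ∈ Aᶜ.erase i, min k (d x) ≥ k * #{x ∈ Aᶜ.erase i | k + 1 ≤ d x} + d j := by
      have h6 : ∑ x ∈ Aᶜ.erase i, min k (d x) ≥ ∑ x ∈ Aᶜ.erase i,
          (k * (if k + 1 ≤ d x then 1 else 0) + if x = j then d j else 0) := by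
        refine sum_le_sum fun x _ => ?_
        split_ifs with h1 h2 h2
        · subst h2; omega
        · omega
        · subst h2; omega
        · omega
      rw [sum_add_distrib, ← mul_sum, ← card_filter] at h6
      simpa [hij.symm, hjA] using h6
    have h7 : ∑ x ∈ Aᶜ, min k (d x) = min k (d i) + ∑ x ∈ Aᶜ.erase i, min k (d x) :=
      (add_sum_erase _ (fun x => min k (d x)) (by simp [hiA])).symm
    set q := #{x ∈ Aᶜ.erase i | k + 1 ≤ d x}
    have h8 : (k + 1) * (k + 1) = k * k + 2 * k + 1 := by ring
    have h9 : d i ≤ k + q := by omega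
    have h10 : k * d i ≤ k * k + k * q := by rw [← mul_add]; exact Nat.mul_le_mul_left _ h9
    omega

/-- Induction on the sum: a largest entry i and a smallest other positive entry j are lowered by one
and the result is realized. Then the edge ij is added, or a switch raises both degrees if ij is
already present. -/
theorem exists_degree_eq_of_egAt (s : ℕ) : ∀ d : V → ℕ, ∑ i, d i = s → Even s →
    (∀ A, EGAt d A) → ∃ (G : SimpleGraph V) (_ : DecidableRel G.Adj), ∀ i, G.degree i = d i := by
  induction s using Nat.strong_induction_on with
  | _ s ih =>
  intro d hs he h
  by_cases h0 : ∀ i, d i = 0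
  · exact ⟨⊥, inferInstance, fun i => by simp [h0]⟩
  push Not at h0
  obtain ⟨x, hx⟩ := h0
  obtain ⟨i, -, hi⟩ := exists_max_image univ d ⟨x, mem_univ x⟩
  replace hi : ∀ x, d x ≤ d i := fun x => hi x (mem_univ x)
  have hpi : 0 < d i := (Nat.pos_of_ne_zero hx).trans_le (hi x)
  -- The inequality at {i}: at least d i candidates for neighbours of i.
  have hcard : d i ≤ #{x | x ≠ i ∧ 0 < d x} := by
    have := h {i}
    simp only [EGAt, sum_singleton, card_singleton] at this
    have h2 : ∑ x ∈ ({i} : Finset V)ᶜ, min 1 (d x) = #{x | x ≠ i ∧ 0 < d x} := by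
      rw [card_filter, ← sum_filter_add_sum_filter_not univ (· ≠ i)]
      have : ∑ x with ¬ x ≠ i, (if x ≠ i ∧ 0 < d x then 1 else 0) = 0 :=
        sum_eq_zero fun x hx => by
          rw [if_neg]; rw [mem_filter] at hx; tauto
      rw [this, add_zero]
      have h3 : ({i} : Finset V)ᶜ = univ.filter (· ≠ i) := by ext; simp
      rw [h3]
      refine sum_congr rfl fun x hx => ?_
      rw [mem_filter] at hx
      simp only [hx.2, ne_eq, not_false_eq_true, true_and]
      split_ifs <;> omega
    omega
  obtain ⟨j, hj, hjm⟩ := exists_min_image {x | x ≠ i ∧ 0 < d x} d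
    (card_pos.1 (hpi.trans_le hcard))
  simp only [mem_filter_univ] at hj hjm
  obtain ⟨hji, hj⟩ := hj
  set d' := Function.update (Function.update d i (d i - 1)) j (d j - 1) with hd'
  have di : d' i + 1 = d i := by
    simp [hd', Function.update_of_ne hji.symm]; omega
  have dj : d' j + 1 = d j := by simp [hd']; omega
  have dx : ∀ x, x ≠ i → x ≠ j → d' x = d x := fun x h1 h2 => by
    simp [hd', h1, h2]
  have dd : ∀ x, d x = d' x + (if x = i then 1 else 0) + (if x = j then 1 else 0) := by
    intro x
    by_cases h1 : x = i
    · subst h1; simp [hji.symm, ← di]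
    by_cases h2 : x = j
    · subst h2; simp [hji, ← dj]
    · simp [h1, h2, dx x h1 h2]
  have hsum : ∑ x, d' x + 2 = s := by
    rw [← hs, sum_congr rfl fun x _ => dd x, sum_add_distrib, sum_add_distrib]
    simp
  obtain ⟨G, _, hG⟩ := ih (∑ x, d' x) (by omega) d' rfl
    (by rw [Nat.even_iff] at *; omega)
    (EGAt.lower_pair h (by rwa [hs]) hji.symm hi hj)
  simp_rw [dd, ← hG]
  by_cases hadj : G.Adj i j
  swap
  · exact G.exists_add_edge hji.symm hadj
  -- In G the vertex i has only d i - 1 neighbours.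
  obtain ⟨v, hv, hvn⟩ : ∃ v ∈ ({x | x ≠ i ∧ 0 < d x} : Finset V), v ∉ G.neighborFinset i := by
    by_contra! hc
    have := card_le_card (show ({x | x ≠ i ∧ 0 < d x} : Finset V) ⊆ G.neighborFinset i from hc)
    rw [G.card_neighborFinset_eq_degree, hG] at this
    omega
  simp only [mem_filter_univ, SimpleGraph.mem_neighborFinset] at hv hvn
  have hvj : v ≠ j := by rintro rfl; exact hvn hadj
  have hdeg : G.degree j < G.degree v := by
    rw [hG, hG, dx v hv.1 hvj]
    have := hjm v hv
    omega
  -- As i is adjacent to j but not to v, it may be dropped from the neighbours of j. This makes room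
  -- for excluding w = j while the excluded set still has at most deg j < deg v members.
  obtain ⟨w, hw, hwn⟩ : ∃ w ∈ G.neighborFinset v, w ∉ insert j (G.neighborFinset j \ {i}) := by
    by_contra! hc
    have h1 := card_le_card (show G.neighborFinset v ⊆ insert j (G.neighborFinset j \ {i}) from hc)
    have h2 := card_insert_le j (G.neighborFinset j \ {i})
    rw [card_sdiff_of_subset (by simpa using hadj.symm), G.card_neighborFinset_eq_degree] at h2
    rw [G.card_neighborFinset_eq_degree] at h1
    simp only [card_singleton] at h2
    have := (G.degree_pos_iff_exists_adj j).2 ⟨i, hadj.symm⟩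
    omega
  simp only [SimpleGraph.mem_neighborFinset, mem_insert, mem_sdiff, mem_singleton, not_or,
    not_and, not_not] at hw hwn
  exact G.exists_switch hji.symm hv.1 hwn.1 hw hvn fun hjw => by
    have := hwn.2 hjw
    subst this
    exact hvn hw.symm
end

/-- The Erdős–Gallai theorem. -/
theorem isGraphic_iff_egAt {n : ℕ} {d : Fin n → ℕ} :
    IsGraphic d ↔ Even (∑ i, d i) ∧ ∀ A, EGAt d A := by
  constructor
  · rintro ⟨G, _, h⟩
    have h' : d = fun i => G.degree i := funext fun i => (h i).symm
    subst h'
    exact ⟨by rw [G.sum_degrees_eq_twice_card_edges]; exact even_two_mul _, G.egAt_degree⟩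
  · rintro ⟨h1, h2⟩
    exact exists_degree_eq_of_egAt _ d rfl h1 h2

/-- The maximum of B is at least #B - 1; it is peeled off against the last term of the range. -/
theorem sum_le_sum_range_card_of_antitone {g : ℕ → ℕ} {m : ℕ}
    (hg : ∀ j k, j ≤ k → k < m → g k ≤ g j) (B : Finset ℕ) (hB : ∀ k ∈ B, k < m) :
    ∑ k ∈ B, g k ≤ ∑ k ∈ range #B, g k := by
  induction hc : #B generalizing B with
  | zero => simp [card_eq_zero.1 hc]
  | succ c ih =>
    have hne : B.Nonempty := card_pos.1 (by omega)
    have hmax := B.max'_mem hne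
    have hle : c ≤ B.max' hne := by
      have : B ⊆ range (B.max' hne + 1) := fun k hk => by
        simpa [Nat.lt_succ_iff] using B.le_max' k hk
      have := card_le_card this
      rw [card_range] at this
      omega
    rw [← sum_erase_add _ _ hmax, sum_range_succ]
    exact Nat.add_le_add
      (ih _ (fun k hk => hB k (mem_of_mem_erase hk)) (by rw [card_erase_of_mem hmax, hc]; rfl))
      (hg _ _ hle (hB _ hmax))

/-! ### The greedy sequence and its basic estimates -/

namespace IntervalSeq

variable {n : ℕ} (S : IntervalSeq n)

/-- The largest `v` such that more than `v` upper ends are at least `v`. -/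
def level : ℕ := Nat.findGreatest (fun v => v < #{i | v ≤ S.hi i}) n

/-- The indices whose lower end is above the level. -/
def highs : Finset (Fin n) := {i | S.level < S.lo i}

/-- The position of `i` when the lower ends are sorted decreasingly. -/
def rank (i : Fin n) : ℕ := #{j | S.lo i < S.lo j ∨ (S.lo j = S.lo i ∧ j < i)}

/-- The lower end at position `k` in the decreasing order. -/
def sortedLo (k : ℕ) : ℕ := ∑ i with S.rank i = k, S.lo i

/-- What the index at position `k` has to receive from the indices that are not high. -/
def demand (k : ℕ) : ℕ := S.sortedLo k + 1 - #S.highs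

/-- The number of indices that are not high and have an upper end above `k`. -/
def gain (k : ℕ) : ℕ := #{i | S.lo i ≤ S.level ∧ k < S.hi i}

/-- The capacity left over after the first `k` positions are served greedily. -/
def residual : ℕ → ℕ
  | 0 => 0
  | k + 1 => residual k + S.gain k - min (S.demand k) (residual k + S.gain k)

/-- What position `k` receives in the greedy distribution. -/
def share (k : ℕ) : ℕ := min (S.demand k) (S.residual k + S.gain k)

/-- The greedy sequence. -/
def greedy (i : Fin n) : ℕ :=
  if S.level < S.lo i then #S.highs - 1 + S.share (S.rank i) else min (S.hi i) S.level

/-- The last position without a residual. -/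
def lastTight : ℕ := Nat.findGreatest (fun k => S.residual k = 0) #S.highs

/-! ### The level and the order -/

theorem level_lt_card [NeZero n] : S.level < #{i | S.level ≤ S.hi i} :=
  Nat.findGreatest_spec (P := fun v => v < #{i | v ≤ S.hi i}) (Nat.zero_le n)
    (by simpa using Nat.pos_of_ne_zero (NeZero.ne n))

theorem le_level {v : ℕ} (h : v < #{i | v ≤ S.hi i}) : v ≤ S.level :=
  Nat.le_findGreatest (h.le.trans ((card_le_univ _).trans (by simp))) h

theorem card_level_lt_hi : #{i | S.level < S.hi i} ≤ S.level + 1 := by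
  by_contra! h
  have := S.le_level (v := S.level + 1) h
  omega

theorem mem_highs {i : Fin n} : i ∈ S.highs ↔ S.level < S.lo i := by simp [highs]

theorem highs_subset : S.highs ⊆ ({i | S.level < S.hi i} : Finset (Fin n)) := fun i hi => by
  rw [mem_filter_univ]; exact (S.mem_highs.1 hi).trans_le (S.lo_le_hi i)

theorem card_highs_le : #S.highs ≤ S.level + 1 :=
  (card_le_card S.highs_subset).trans S.card_level_lt_hi

theorem rank_lt_rank {i j : Fin n} (h : S.lo j < S.lo i ∨ (S.lo i = S.lo j ∧ i < j)) :
    S.rank i < S.rank j := by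
  refine card_lt_card (ssubset_iff_of_subset (fun k hk => ?_) |>.2 ⟨i, ?_, ?_⟩)
  · simp only [mem_filter_univ] at *
    rcases h with h | h <;> rcases hk with hk | hk
    · left; omega
    · left; omega
    · left; omega
    · right; exact ⟨by omega, hk.2.trans h.2⟩
  · simp only [mem_filter_univ]; omega
  · simp

theorem rank_injective : Function.Injective S.rank := by
  intro i j h
  by_contra hne
  rcases lt_trichotomy (S.lo i) (S.lo j) with h1 | h1 | h1
  · have := S.rank_lt_rank (i := j) (j := i) (Or.inl h1); omega
  · rcases lt_or_gt_of_ne hne with h2 | h2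
    · have := S.rank_lt_rank (Or.inr ⟨h1, h2⟩); omega
    · have := S.rank_lt_rank (Or.inr ⟨h1.symm, h2⟩); omega
  · have := S.rank_lt_rank (Or.inl h1); omega

theorem rank_lt (i : Fin n) : S.rank i < n := by
  have : ({j | S.lo i < S.lo j ∨ (S.lo j = S.lo i ∧ j < i)} : Finset (Fin n)) ⊂ univ :=
    filter_ssubset.2 ⟨i, mem_univ i, by simp⟩
  simpa [rank] using card_lt_card this

theorem exists_rank_eq {k : ℕ} (hk : k < n) : ∃ i, S.rank i = k := by
  have hinj : Function.Injective fun i => (⟨S.rank i, S.rank_lt i⟩ : Fin n) := fun i j h =>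
    S.rank_injective (by simpa using h)
  obtain ⟨i, hi⟩ := Finite.injective_iff_surjective.1 hinj ⟨k, hk⟩
  exact ⟨i, by simpa using hi⟩

theorem lo_le_of_rank_le {i j : Fin n} (h : S.rank i ≤ S.rank j) : S.lo j ≤ S.lo i := by
  by_contra! hlt
  have := S.rank_lt_rank (i := j) (j := i) (Or.inl hlt)
  omega

theorem sortedLo_rank (i : Fin n) : S.sortedLo (S.rank i) = S.lo i := by
  have : ({j | S.rank j = S.rank i} : Finset (Fin n)) = {i} := by
    ext j; simpa using S.rank_injective.eq_iff
  rw [sortedLo, this, sum_singleton]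

theorem sortedLo_antitone {j k : ℕ} (h : j ≤ k) (hk : k < n) : S.sortedLo k ≤ S.sortedLo j := by
  obtain ⟨i, rfl⟩ := S.exists_rank_eq hk
  obtain ⟨i', rfl⟩ := S.exists_rank_eq (h.trans_lt hk)
  rw [sortedLo_rank, sortedLo_rank]
  exact S.lo_le_of_rank_le h

theorem card_highs_le_card : #S.highs ≤ n := (card_le_univ _).trans (by simp)

/-- Everything that precedes a high index is high, so the high indices form an initial segment of
the order. -/
theorem image_rank_highs : S.highs.image S.rank = range #S.highs := by
  have hc : #(S.highs.image S.rank) = #S.highs := card_image_of_injective _ S.rank_injective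
  refine eq_of_subset_of_card_le (fun k hk => ?_) (by rw [hc, card_range])
  obtain ⟨i, hi, rfl⟩ := mem_image.1 hk
  rw [mem_range]
  rw [mem_highs] at hi
  refine card_lt_card (ssubset_iff_of_subset (fun k hk => ?_) |>.2 ⟨i, S.mem_highs.2 hi, by simp⟩)
  rw [mem_filter_univ] at hk
  rw [mem_highs]
  omega

theorem rank_lt_card_highs {i : Fin n} : S.rank i < #S.highs ↔ S.level < S.lo i := by
  rw [← mem_range, ← S.image_rank_highs, S.rank_injective.mem_finset_image, mem_highs]

theorem card_rank_lt {K : ℕ} (hK : K ≤ n) : #{i | S.rank i < K} = K := by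
  rw [← card_image_of_injective _ S.rank_injective]
  convert card_range K
  ext k
  simp only [mem_image, mem_filter_univ, mem_range]
  constructor
  · rintro ⟨i, hi, rfl⟩; exact hi
  · intro hk
    obtain ⟨i, rfl⟩ := S.exists_rank_eq (hk.trans_le hK)
    exact ⟨i, hk, rfl⟩

theorem sum_rank_lt (g : ℕ → ℕ) {K : ℕ} (hK : K ≤ n) :
    ∑ i with S.rank i < K, g (S.rank i) = ∑ k ∈ range K, g k := by
  rw [← sum_image (f := g) (g := S.rank) fun _ _ _ _ h => S.rank_injective h]
  congr 1
  ext k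
  simp only [mem_image, mem_filter_univ, mem_range]
  constructor
  · rintro ⟨i, hi, rfl⟩; exact hi
  · intro hk
    obtain ⟨i, rfl⟩ := S.exists_rank_eq (hk.trans_le hK)
    exact ⟨i, hk, rfl⟩

/-! ### The greedy distribution -/

theorem share_add_residual (k : ℕ) :
    S.share k + S.residual (k + 1) = S.residual k + S.gain k := by
  rw [share, residual]; omega

/-- Conservation of capacity: what is offered is either distributed or carried on. -/
theorem sum_share_add_residual (k : ℕ) :
    ∑ j ∈ range k, S.share j + S.residual k = ∑ j ∈ range k, S.gain j := by
  induction k with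
  | zero => simp [residual]
  | succ k ih =>
    have := S.share_add_residual k
    rw [sum_range_succ, sum_range_succ]
    omega

theorem gain_antitone {j k : ℕ} (h : j ≤ k) : S.gain k ≤ S.gain j :=
  card_le_card fun i hi => by
    simp only [mem_filter_univ] at *
    omega

theorem demand_antitone {j k : ℕ} (h : j ≤ k) (hk : k < #S.highs) : S.demand k ≤ S.demand j := by
  have := S.sortedLo_antitone h (hk.trans_le S.card_highs_le_card)
  unfold demand
  omega

/-- Demands and gains both decrease. If a position is not fully served, nothing is carried on, and
the next one gets at most its own smaller gain. -/
theorem share_antitone (j k : ℕ) (h : j ≤ k) (hk : k < #S.highs) : S.share k ≤ S.share j := by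
  induction k, h using Nat.le_induction with
  | base => rfl
  | succ k h ih =>
    refine le_trans ?_ (ih (by omega))
    have h1 := S.demand_antitone k.le_succ hk
    have h2 := S.gain_antitone k.le_succ
    simp only [share, residual, Nat.succ_eq_add_one] at *
    omega

/-- Double counting of the pairs (i, j) with i not high and j < min(k, hi i). -/
theorem sum_gain (k : ℕ) : ∑ j ∈ range k, S.gain j = ∑ i ∈ S.highsᶜ, min k (S.hi i) := by
  have h1 : ∀ j, S.gain j = ∑ i ∈ S.highsᶜ, if j < S.hi i then 1 else 0 := fun j => by
    rw [← card_filter, gain]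
    congr 1
    ext i
    simp [mem_highs]
  simp_rw [h1]
  rw [sum_comm]
  refine sum_congr rfl fun i _ => ?_
  rw [← card_filter]
  convert card_range (min k (S.hi i)) using 2
  ext j
  simp

theorem greedy_of_mem {i : Fin n} (h : i ∈ S.highs) :
    S.greedy i = #S.highs - 1 + S.share (S.rank i) := if_pos (S.mem_highs.1 h)

theorem greedy_of_notMem {i : Fin n} (h : i ∉ S.highs) :
    S.greedy i = min (S.hi i) S.level := if_neg (by rwa [mem_highs] at h)

theorem greedy_le_level {i : Fin n} (h : i ∉ S.highs) : S.greedy i ≤ S.level := by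
  rw [S.greedy_of_notMem h]; exact min_le_right _ _

/-- Capping at the level is invisible when k is at most the level. Otherwise k = #highs = level + 1,
so the high indices are all those with upper end above the level and there is nothing to cap. -/
theorem min_greedy {k : ℕ} (hk : k ≤ #S.highs) {i : Fin n} (hi : i ∉ S.highs) :
    min k (S.greedy i) = min k (S.hi i) := by
  rw [S.greedy_of_notMem hi]
  by_cases hkl : k ≤ S.level
  · omega
  have h1 := S.card_highs_le
  have h2 := eq_of_subset_of_card_le S.highs_subset (S.card_level_lt_hi.trans (by omega))
  rw [h2, mem_filter_univ] at hi
  omega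

theorem sum_gain_eq {k : ℕ} (hk : k ≤ #S.highs) :
    ∑ j ∈ range k, S.gain j = ∑ i ∈ S.highsᶜ, min k (S.greedy i) := by
  rw [sum_gain]
  exact sum_congr rfl fun i hi => (S.min_greedy hk (by simpa using hi)).symm

/-- More than `level` upper ends reach the level. As long as the rank is below the level, each of
them belongs to a high index or is counted in the gain, so clique and gain together suffice.
Otherwise the clique alone gives #highs - 1 = level. -/
theorem level_le_greedy [NeZero n] {i : Fin n} (hi : i ∈ S.highs) : S.level ≤ S.greedy i := by
  have hr := S.rank_lt_card_highs.2 (S.mem_highs.1 hi)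
  have hm := S.card_highs_le
  have hl := S.mem_highs.1 hi
  rw [S.greedy_of_mem hi]
  by_cases h : S.rank i + 1 ≤ S.level
  · have h1 : #{i | S.level ≤ S.hi i} ≤ #S.highs + S.gain (S.rank i) := by
      refine (card_le_card fun j hj => ?_).trans (card_union_le _ _)
      rw [mem_union, mem_highs, mem_filter_univ]
      rw [mem_filter_univ] at hj
      omega
    have h2 := S.level_lt_card
    rw [share, demand, sortedLo_rank]
    omega
  · omega

theorem greedy_le_lo {i : Fin n} (hi : i ∈ S.highs) : S.greedy i ≤ S.lo i := by
  have hr := S.rank_lt_card_highs.2 (S.mem_highs.1 hi)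
  have hm := S.card_highs_le
  have hl := S.mem_highs.1 hi
  rw [S.greedy_of_mem hi, share, demand, sortedLo_rank]
  omega

theorem greedy_le_hi (i : Fin n) : S.greedy i ≤ S.hi i := by
  by_cases hi : i ∈ S.highs
  · exact (S.greedy_le_lo hi).trans (S.lo_le_hi i)
  · rw [S.greedy_of_notMem hi]; exact min_le_left _ _

theorem lo_le_greedy {i : Fin n} (hi : i ∉ S.highs) : S.lo i ≤ S.greedy i := by
  rw [S.greedy_of_notMem hi]
  rw [mem_highs, not_lt] at hi
  exact le_min (S.lo_le_hi i) hi

theorem sum_greedy_add_card {B : Finset (Fin n)} (hB : B ⊆ S.highs) :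
    ∑ i ∈ B, S.greedy i + #B = #B * #S.highs + ∑ i ∈ B, S.share (S.rank i) := by
  rw [card_eq_sum_ones, ← sum_add_distrib, sum_mul, ← sum_add_distrib]
  refine sum_congr rfl fun i hi => ?_
  rw [S.greedy_of_mem (hB hi)]
  have := card_pos.2 ⟨i, hB hi⟩
  omega

theorem sum_share_le {B : Finset (Fin n)} (hB : B ⊆ S.highs) :
    ∑ i ∈ B, S.share (S.rank i) ≤ ∑ k ∈ range #B, S.share k := by
  have h := sum_le_sum_range_card_of_antitone S.share_antitone (B.image S.rank) (by
    rintro k hk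
    obtain ⟨i, hi, rfl⟩ := mem_image.1 hk
    exact S.rank_lt_card_highs.2 (S.mem_highs.1 (hB hi)))
  rwa [sum_image fun _ _ _ _ h => S.rank_injective h,
    card_image_of_injective _ S.rank_injective] at h

/-- Among high sets of a given size the first positions receive most, and their total is limited by
the capacity offered. -/
theorem sum_greedy_le {B : Finset (Fin n)} (hB : B ⊆ S.highs) :
    ∑ i ∈ B, S.greedy i + #B ≤ #B * #S.highs + ∑ i ∈ S.highsᶜ, min #B (S.greedy i) := by
  have h := S.sum_share_le hB
  rw [S.sum_greedy_add_card hB, ← S.sum_gain_eq (card_le_card hB), ← S.sum_share_add_residual]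
  omega

end IntervalSeq

/-! ### Erdős–Gallai inequalities and tight sets of the greedy sequence -/

namespace IntervalSeq

variable {n : ℕ} (S : IntervalSeq n)

theorem sum_split (A : Finset (Fin n)) (g : Fin n → ℕ) :
    ∑ i ∈ A, g i = ∑ i ∈ A ∩ S.highs, g i + ∑ i ∈ A \ S.highs, g i :=
  (sum_inter_add_sum_sdiff A S.highs g).symm

theorem sum_compl_split (A : Finset (Fin n)) (g : Fin n → ℕ) :
    ∑ i ∈ Aᶜ, g i = ∑ i ∈ S.highs \ A, g i + ∑ i ∈ (A ∪ S.highs)ᶜ, g i := by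
  rw [S.sum_split Aᶜ g]
  congr 2
  · ext i; simp; tauto
  · ext i; simp

theorem sum_highs_compl_split (A : Finset (Fin n)) (g : Fin n → ℕ) :
    ∑ i ∈ S.highsᶜ, g i = ∑ i ∈ A \ S.highs, g i + ∑ i ∈ (A ∪ S.highs)ᶜ, g i := by
  rw [← sum_inter_add_sum_sdiff S.highsᶜ A g]
  congr 2 <;> ext i <;> simp <;> tauto

/-- An index whose upper end reaches the level is high or has greedy value exactly the level. -/
theorem level_lt_add_card [NeZero n] (A : Finset (Fin n)) :
    S.level < #S.highs + #(A \ S.highs) + #{i ∈ (A ∪ S.highs)ᶜ | S.greedy i = S.level} := by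
  refine S.level_lt_card.trans_le ((card_le_card fun i hi => ?_).trans
    ((card_union_le _ _).trans (Nat.add_le_add_right (card_union_le S.highs (A \ S.highs)) _)))
  rw [mem_filter_univ] at hi
  by_cases h : i ∈ S.highs
  · simp [h]
  · have := S.greedy_of_notMem h
    simp only [mem_union, mem_filter, mem_compl, mem_sdiff, h]
    have : S.greedy i = S.level := by omega
    tauto

theorem sum_sdiff_highs_le (A : Finset (Fin n)) (h : ℕ) :
    ∑ i ∈ A \ S.highs, S.greedy i + ∑ i ∈ A \ S.highs, min h (S.greedy i) ≤
      #(A \ S.highs) * (S.level + min h S.level) := by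
  rw [← sum_add_distrib, ← smul_eq_mul]
  refine sum_le_card_nsmul _ _ _ fun i hi => ?_
  have := S.greedy_le_level (mem_sdiff.1 hi).2
  omega

theorem gap_le {x l h k : ℕ} (hk : h ≤ k) :
    min h x + (min k l - min h l) * (if x = l then 1 else 0) ≤ min k x := by
  split_ifs with hx
  · subst hx; omega
  · omega

theorem sum_compl_union_le (A : Finset (Fin n)) {h k : ℕ} (hk : h ≤ k) :
    ∑ i ∈ (A ∪ S.highs)ᶜ, min h (S.greedy i) +
        (min k S.level - min h S.level) * #{i ∈ (A ∪ S.highs)ᶜ | S.greedy i = S.level} ≤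
      ∑ i ∈ (A ∪ S.highs)ᶜ, min k (S.greedy i) := by
  rw [card_filter, mul_sum, ← sum_add_distrib]
  exact sum_le_sum fun i _ => gap_le hk

theorem le_sum_highs_sdiff [NeZero n] (A : Finset (Fin n)) (k : ℕ) :
    #(S.highs \ A) * min k S.level ≤ ∑ i ∈ S.highs \ A, min k (S.greedy i) := by
  rw [← smul_eq_mul]
  refine card_nsmul_le_sum _ _ _ fun i hi => ?_
  have := S.level_le_greedy (mem_sdiff.1 hi).1
  omega

/-- The numerical core of the Erdős–Gallai inequalities for the greedy sequence: `h` and `s` count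
the members of the set that are high or not, `g` the high indices outside, `N` the others outside
that are at the level `l`. -/
theorem greedy_numeric {h s g l N : ℕ} (hl : l < h + g + s + N) (hm : h + g ≤ l + 1) :
    h * (h + g) + s * (l + min h l) + (h + s) ≤
      (h + s) * (h + s) + g * min (h + s) l + (min (h + s) l - min h l) * N + h := by
  rcases le_or_gt (h + s) l with hk | hk
  · rw [min_eq_left hk, min_eq_left (by omega : h ≤ l), Nat.add_sub_cancel_left]
    have : s * (l + 1) ≤ s * (h + g + s + N) := Nat.mul_le_mul_left _ hl
    nlinarith
  · rw [min_eq_right hk.le]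
    rcases le_or_gt h l with hh | hh
    · rw [min_eq_left hh]
      obtain ⟨t, rfl⟩ := Nat.exists_eq_add_of_le hh
      rw [Nat.add_sub_cancel_left]
      obtain ⟨u, rfl⟩ : ∃ u, s = t + 1 + u := ⟨s - (t + 1), by omega⟩
      nlinarith [Nat.zero_le (u * u), Nat.zero_le (t * N)]
    · rw [min_eq_right hh.le]
      obtain rfl : h = l + 1 := by omega
      obtain rfl : g = 0 := by omega
      nlinarith

/-- The high part of A is covered by `sum_greedy_le`. Each further member contributes at most the
level; this is balanced by the more than `level` indices that are high, in A, or at the level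
outside. -/
theorem egAt_greedy [NeZero n] (A : Finset (Fin n)) : EGAt S.greedy A := by
  have b1 := S.sum_greedy_le (B := A ∩ S.highs) inter_subset_right
  rw [S.sum_highs_compl_split A] at b1
  have b2 := S.sum_sdiff_highs_le A #(A ∩ S.highs)
  have b3 := S.sum_compl_union_le A (card_le_card (inter_subset_left : A ∩ S.highs ⊆ A))
  have b4 := S.le_sum_highs_sdiff A #A
  have b5 := S.level_lt_add_card A
  have hA : #(A ∩ S.highs) + #(A \ S.highs) = #A := card_inter_add_card_sdiff A S.highs
  have hH : #(A ∩ S.highs) + #(S.highs \ A) = #S.highs := by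
    rw [inter_comm]; exact card_inter_add_card_sdiff _ _
  have hm := S.card_highs_le
  rw [← hH] at b5 b1 hm
  rw [← hA] at b3 b4
  have := greedy_numeric b5 hm
  unfold EGAt
  rw [S.sum_split A, S.sum_compl_split A, ← hA]
  omega

/-- For #A at most the level, a member that is not high (s > 0) makes every estimate behind
`egAt_greedy` an equality. X, Y are the sums over the high and other members; F, W, W', G are sums
of minima with h or h + s. -/
theorem greedy_numeric_tight {h s g l N X Y F W W' G : ℕ} (hs : 0 < s)
    (b1 : X + h ≤ h * (h + g) + (F + W)) (b2 : Y + F ≤ s * (l + h)) (b3 : W + s * N ≤ W')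
    (b4 : g * (h + s) ≤ G) (b5 : l < h + g + s + N)
    (ht : X + Y + (h + s) = (h + s) * (h + s) + (G + W')) :
    l + 1 = h + g + s + N ∧ X + h = h * (h + g) + (F + W) ∧ Y + F = s * (l + h) ∧
      W + s * N = W' := by
  have e1 : h * (h + g) + s * (l + h) + (h + s) + s * (h + g + s + N) =
      (h + s) * (h + s) + g * (h + s) + s * N + h + s * (l + 1) := by ring
  have e2 : s * (l + 1) ≤ s * (h + g + s + N) := Nat.mul_le_mul_left _ b5
  have e3 : l + 1 = h + g + s + N := Nat.eq_of_mul_eq_mul_left hs (by omega)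
  rw [e3] at e1
  exact ⟨e3, by omega, by omega, by omega⟩

/-- The reverse Erdős–Gallai inequality for a set of l + 1 indices; R is the sum of the entries
outside it. -/
theorem tight_numeric {h s g l N X G R : ℕ} (hl : l + 1 = h + g + s + N)
    (hX : X + h = h * (h + g) + (s * h + (N * h + R))) (hG : g * l ≤ G) :
    (l + 1) * (l + 1) + R ≤ X + G + s * l + N * l + (l + 1) := by
  have e1 : X + h = h * (l + 1) + R := by rw [hX, hl]; ring
  have e2 : (l + 1) * (l + 1) = h * l + g * l + s * l + N * l + (l + 1) := by
    calc (l + 1) * (l + 1) = (l + 1) * l + (l + 1) := by ring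
      _ = (h + g + s + N) * l + (l + 1) := by rw [← hl]
      _ = _ := by ring
  rw [mul_add, mul_one] at e1
  omega

/-- A tight set not above the level in size which has a member that is not high extends to a tight
set consisting of the indices at the level or above it. -/
theorem even_sum_of_egTight_of_not_subset [NeZero n] {A : Finset (Fin n)}
    (hA : EGTight S.greedy A) (hkl : #A ≤ S.level) (hsub : ¬ A ⊆ S.highs) :
    Even (∑ i, S.greedy i) := by
  have b1 := S.sum_greedy_le (B := A ∩ S.highs) inter_subset_right
  rw [S.sum_highs_compl_split A] at b1
  have b2 := S.sum_sdiff_highs_le A #(A ∩ S.highs)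
  have b3 := S.sum_compl_union_le A (card_le_card (inter_subset_left : A ∩ S.highs ⊆ A))
  have b4 := S.le_sum_highs_sdiff A #A
  have b5 := S.level_lt_add_card A
  have hcA : #(A ∩ S.highs) + #(A \ S.highs) = #A := card_inter_add_card_sdiff A S.highs
  have hH : #(A ∩ S.highs) + #(S.highs \ A) = #S.highs := by
    rw [inter_comm]; exact card_inter_add_card_sdiff _ _
  have hs : 0 < #(A \ S.highs) := card_pos.2 (sdiff_nonempty.2 hsub)
  rw [← hH] at b5 b1
  have ht := hA
  unfold EGTight at ht
  rw [S.sum_split A, S.sum_compl_split A, ← hcA] at ht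
  rw [min_eq_left hkl] at b3 b4
  rw [min_eq_left (by omega : #(A ∩ S.highs) ≤ S.level)] at b2 b3
  rw [← hcA, Nat.add_sub_cancel_left] at b3
  rw [← hcA] at b4
  rw [← hcA] at hkl
  obtain ⟨e5, e1, e2, e3⟩ := greedy_numeric_tight hs b1 b2 b3 b4 b5 ht
  clear b1 b2 b3 b4 b5 ht hcA
  rw [← sum_add_distrib, ← smul_eq_mul, ← sum_const, sum_eq_sum_iff_of_le (fun i hi => by
    have := S.greedy_le_level (mem_sdiff.1 hi).2; omega)] at e2
  have hW : ∀ i, i ∈ (A ∪ S.highs)ᶜ ↔ i ∉ A ∧ i ∉ S.highs := fun i => by simp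
  generalize (A ∪ S.highs)ᶜ = W at *
  rw [card_filter, mul_sum, ← sum_add_distrib, sum_eq_sum_iff_of_le (fun i _ => by
    split_ifs <;> omega), ] at e3
  have hA2 : ∀ i ∈ A \ S.highs, S.greedy i = S.level := fun i hi => by
    have := e2 i hi
    have := S.greedy_le_level (mem_sdiff.1 hi).2
    omega
  -- The minima with #(A ∩ highs) and with the larger #A agree, so the entry is at most the smaller
  -- bound.
  have hW2 : ∀ i ∈ W, S.greedy i ≠ S.level → S.greedy i ≤ #(A ∩ S.highs) := fun i hi hne => by
    have := e3 i hi
    rw [if_neg hne] at this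
    omega
  clear e2 e3
  have f2 : ∑ i ∈ W, min #(A ∩ S.highs) (S.greedy i) =
      #{i ∈ W | S.greedy i = S.level} * #(A ∩ S.highs) +
        ∑ i ∈ W with ¬ S.greedy i = S.level, S.greedy i := by
    rw [← sum_filter_add_sum_filter_not W (fun i => S.greedy i = S.level)]
    congr 1
    · rw [← smul_eq_mul, ← sum_const]
      refine sum_congr rfl fun i hi => ?_
      have := (mem_filter.1 hi).2
      omega
    · refine sum_congr rfl fun i hi => ?_
      have h1 := (mem_filter.1 hi).2
      have h2 := hW2 i (mem_filter.1 hi).1 h1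
      omega
  have f3 : ∑ i ∈ A \ S.highs, min #(A ∩ S.highs) (S.greedy i) =
      #(A \ S.highs) * #(A ∩ S.highs) := by
    rw [← smul_eq_mul, ← sum_const]
    exact sum_congr rfl fun i hi => by rw [hA2 i hi]; omega
  have f5 : #(S.highs \ A) * S.level ≤ ∑ i ∈ S.highs \ A, S.greedy i := by
    rw [← smul_eq_mul, ← sum_const]
    exact sum_le_sum fun i hi => S.level_le_greedy (mem_sdiff.1 hi).1
  rw [f2, f3] at e1
  have key := tight_numeric e5 e1 f5
  have dj2 : Disjoint (S.highs ∪ (A \ S.highs)) ({i ∈ W | S.greedy i = S.level}) := by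
    rw [disjoint_left]
    intro i hi hi'
    simp only [mem_union, mem_sdiff, mem_filter, hW] at hi hi'
    tauto
  have hTc : (S.highs ∪ (A \ S.highs) ∪ {i ∈ W | S.greedy i = S.level})ᶜ =
      {i ∈ W | ¬ S.greedy i = S.level} := by
    ext i
    simp only [mem_compl, mem_union, mem_sdiff, mem_filter, hW]
    tauto
  have hTcard : #(S.highs ∪ (A \ S.highs) ∪ {i ∈ W | S.greedy i = S.level}) = S.level + 1 := by
    rw [card_union_of_disjoint dj2, card_union_of_disjoint disjoint_sdiff, ← hH, e5]
  have hTsum : ∑ i ∈ S.highs ∪ (A \ S.highs) ∪ {i ∈ W | S.greedy i = S.level}, S.greedy i =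
      ∑ i ∈ A ∩ S.highs, S.greedy i + ∑ i ∈ S.highs \ A, S.greedy i +
        #(A \ S.highs) * S.level + #{i ∈ W | S.greedy i = S.level} * S.level := by
    rw [sum_union dj2, sum_union disjoint_sdiff, sum_congr rfl hA2,
      sum_congr rfl fun i hi => (mem_filter.1 hi).2, sum_const, sum_const,
      inter_comm A, sum_inter_add_sum_sdiff S.highs A, smul_eq_mul, smul_eq_mul]
  generalize hT : S.highs ∪ (A \ S.highs) ∪ {i ∈ W | S.greedy i = S.level} = T at *
  have hTle : ∀ i ∉ T, S.greedy i ≤ S.level := fun i hi => by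
    rw [← mem_compl, hTc, mem_filter, hW] at hi
    exact S.greedy_le_level hi.1.2
  -- T is tight because `key` reverses its inequality, and all entries outside T are at most the
  -- level, which is below #T.
  refine EGTight.even_sum (A := T) (le_antisymm (S.egAt_greedy T) ?_) fun i hi =>
    (hTle i hi).trans (by omega)
  have f1 : ∑ i ∈ Tᶜ, min #T (S.greedy i) = ∑ i ∈ W with ¬ S.greedy i = S.level, S.greedy i := by
    rw [← hTc]
    refine sum_congr rfl fun i hi => ?_
    have := hTle i (mem_compl.1 hi)
    omega
  rw [f1, hTsum, hTcard]
  exact key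

/-- Equality in the estimates forces the high indices outside A down to the level. Hence all entries
outside A are at most #A. -/
theorem even_sum_of_egTight_of_level_lt [NeZero n] {A : Finset (Fin n)}
    (hA : EGTight S.greedy A) (hkl : S.level < #A) : Even (∑ i, S.greedy i) := by
  have b1 := S.sum_greedy_le (B := A ∩ S.highs) inter_subset_right
  rw [S.sum_highs_compl_split A] at b1
  have b2 := S.sum_sdiff_highs_le A #(A ∩ S.highs)
  have b3 := S.sum_compl_union_le A (card_le_card (inter_subset_left : A ∩ S.highs ⊆ A))
  have b4 := S.le_sum_highs_sdiff A #A
  have b5 := S.level_lt_add_card A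
  have hcA : #(A ∩ S.highs) + #(A \ S.highs) = #A := card_inter_add_card_sdiff A S.highs
  have hH : #(A ∩ S.highs) + #(S.highs \ A) = #S.highs := by
    rw [inter_comm]; exact card_inter_add_card_sdiff _ _
  have hm := S.card_highs_le
  rw [← hH] at b5 b1 hm
  have hnum := greedy_numeric b5 hm
  have ht := hA
  unfold EGTight at ht
  rw [S.sum_split A, S.sum_compl_split A] at ht
  rw [hcA, min_eq_right hkl.le] at hnum
  rw [min_eq_right hkl.le] at b4 b3
  refine hA.even_sum fun i hi => ?_
  by_cases hiH : i ∈ S.highs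
  swap
  · exact (S.greedy_le_level hiH).trans hkl.le
  have e4 : ∑ i ∈ S.highs \ A, S.level = ∑ i ∈ S.highs \ A, min #A (S.greedy i) := by
    rw [sum_const, smul_eq_mul]
    omega
  rw [sum_eq_sum_iff_of_le] at e4
  · have := e4 i (mem_sdiff.2 ⟨hiH, hi⟩)
    omega
  · intro i hi
    have := S.level_le_greedy (mem_sdiff.1 hi).1
    omega

/-- If the greedy sequence has an odd sum, then all tight sets consist of high indices and take
the whole capacity. -/
theorem subset_highs_of_egTight [NeZero n] {A : Finset (Fin n)} (hA : EGTight S.greedy A)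
    (hodd : ¬ Even (∑ i, S.greedy i)) :
    A ⊆ S.highs ∧ ∑ i ∈ A, S.share (S.rank i) = ∑ k ∈ range #A, S.gain k := by
  have hkl : #A ≤ S.level := by
    by_contra! h
    exact hodd (S.even_sum_of_egTight_of_level_lt hA h)
  have hsub : A ⊆ S.highs := by
    by_contra h
    exact hodd (S.even_sum_of_egTight_of_not_subset hA hkl h)
  refine ⟨hsub, ?_⟩
  have hH : #A + #(S.highs \ A) = #S.highs := by
    rw [card_sdiff_of_subset hsub]
    have := card_le_card hsub
    omega
  have h1 := S.sum_share_le hsub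
  have h2 := S.sum_gain_eq (card_le_card hsub)
  have h3 := S.sum_share_add_residual #A
  have h4 := S.sum_greedy_add_card hsub
  have h5 := S.sum_highs_compl_split A (fun i => min #A (S.greedy i))
  rw [sdiff_eq_empty_iff_subset.2 hsub, sum_empty, zero_add] at h5
  have b4 := S.le_sum_highs_sdiff A #A
  unfold EGTight at hA
  rw [S.sum_compl_split A] at hA
  rw [← hH, mul_add] at h4
  rw [min_eq_left hkl, mul_comm] at b4
  omega

end IntervalSeq

/-! ### Lower bounds for the deviation, optimality and parity -/

namespace IntervalSeq

variable {n : ℕ} (S : IntervalSeq n)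

theorem deviation_eq_sum (x : Fin n → ℕ) :
    S.deviation x = ∑ i, ((x i - S.hi i) + (S.lo i - x i)) := sum_add_distrib.symm

theorem sum_min_le (x : Fin n → ℕ) (k : ℕ) (A : Finset (Fin n)) :
    ∑ i ∈ A, min k (x i) ≤
      ∑ i ∈ A, min k (S.hi i) + ∑ i ∈ A, ((x i - S.hi i) + (S.lo i - x i)) := by
  rw [← sum_add_distrib]
  exact sum_le_sum fun i _ => by omega

theorem sum_lo_le (x : Fin n → ℕ) (A : Finset (Fin n)) :
    ∑ i ∈ A, S.lo i ≤ ∑ i ∈ A, x i + ∑ i ∈ A, ((x i - S.hi i) + (S.lo i - x i)) := by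
  rw [← sum_add_distrib]
  exact sum_le_sum fun i _ => by omega

/-- Every set of indices gives a lower bound for the deviation. -/
theorem le_deviation {x : Fin n → ℕ} {A : Finset (Fin n)} (hx : EGAt x A) :
    ∑ i ∈ A, S.lo i + #A ≤ #A * #A + ∑ i ∈ Aᶜ, min #A (S.hi i) + S.deviation x := by
  have h1 := S.sum_lo_le x A
  have h2 := S.sum_min_le x #A Aᶜ
  rw [deviation_eq_sum, ← sum_add_sum_compl A]
  unfold EGAt at hx
  omega

/-- If the lower bound from `A` is attained and every index outside of `A` has a one-point interval
or an upper end of at most `#A`, then the parity of the sum is determined. -/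
theorem even_sum_add {x : Fin n → ℕ} {A : Finset (Fin n)} (hx : EGAt x A)
    (hd : S.deviation x + #A * #A + ∑ i ∈ Aᶜ, min #A (S.hi i) ≤ ∑ i ∈ A, S.lo i + #A)
    (hA : ∀ i ∉ A, S.lo i = S.hi i ∨ S.hi i ≤ #A) :
    Even (∑ i, x i + ∑ i ∈ Aᶜ, if S.hi i ≤ #A then 0 else #A + S.hi i) := by
  have h1 := S.sum_lo_le x A
  have h2 := S.sum_min_le x #A Aᶜ
  rw [deviation_eq_sum, ← sum_add_sum_compl A] at hd
  unfold EGAt at hx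
  -- Attaining the bound makes all estimates equalities. Off A, hi ≤ #A then forces min(#A, x) = x,
  -- while lo = hi > #A forces x = hi and min(#A, x) = #A; the summand #A + hi corrects the parity
  -- in the latter case.
  have h3 : ∑ i ∈ Aᶜ, min #A (x i) =
      ∑ i ∈ Aᶜ, (min #A (S.hi i) + ((x i - S.hi i) + (S.lo i - x i))) := by
    rw [sum_add_distrib]; omega
  rw [sum_eq_sum_iff_of_le fun i _ => by omega] at h3
  have h4 : Even (∑ i ∈ Aᶜ, (min #A (x i) + (x i + if S.hi i ≤ #A then 0 else #A + S.hi i))) := by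
    refine even_sum _ fun i hi => ?_
    have h5 := h3 i hi
    have h6 := hA i (mem_compl.1 hi)
    have h7 := S.lo_le_hi i
    rw [Nat.even_iff]
    split_ifs with h <;> omega
  rw [sum_add_distrib, sum_add_distrib] at h4
  have h5 : Even (#A * #A + #A) := by rw [← Nat.mul_succ]; exact Nat.even_mul_succ_self _
  rw [← sum_add_sum_compl A x]
  rw [Nat.even_iff] at *
  omega

/-! ### Optimality of the greedy sequence -/

/-- The positions before the last tight one. -/
def tightSet : Finset (Fin n) := {i | S.rank i < S.lastTight}

theorem lastTight_le : S.lastTight ≤ #S.highs := Nat.findGreatest_le _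

theorem residual_lastTight : S.residual S.lastTight = 0 :=
  Nat.findGreatest_spec (P := fun k => S.residual k = 0) (Nat.zero_le _) rfl

theorem le_lastTight {k : ℕ} (hk : k ≤ #S.highs) (h : S.residual k = 0) : k ≤ S.lastTight :=
  Nat.le_findGreatest hk h

theorem card_tightSet : #S.tightSet = S.lastTight :=
  S.card_rank_lt (S.lastTight_le.trans S.card_highs_le_card)

theorem mem_tightSet {i : Fin n} : i ∈ S.tightSet ↔ S.rank i < S.lastTight := by simp [tightSet]

theorem tightSet_subset : S.tightSet ⊆ S.highs := fun i hi => by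
  rw [mem_highs, ← rank_lt_card_highs]
  exact (S.mem_tightSet.1 hi).trans_le S.lastTight_le

theorem share_lt {k : ℕ} (h1 : S.lastTight ≤ k) (h2 : k < #S.highs) :
    S.share k < S.residual k + S.gain k := by
  by_contra! h
  have h3 := S.share_add_residual k
  have := S.le_lastTight (k := k + 1) h2 (by omega)
  omega

/-- After the last tight position capacity never runs out, so the demand is met in full. -/
theorem greedy_eq_lo {i : Fin n} (hi : i ∈ S.highs) (h : i ∉ S.tightSet) :
    S.greedy i = S.lo i := by
  rw [mem_tightSet, not_lt] at h
  have h1 := S.mem_highs.1 hi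
  have h2 := S.rank_lt_card_highs.2 h1
  have h3 := S.share_lt h h2
  have h4 := S.card_highs_le
  rw [S.greedy_of_mem hi]
  rw [share, demand, sortedLo_rank] at *
  omega

theorem lastTight_lt_lo {i : Fin n} (hi : i ∈ S.highs) : S.lastTight ≤ S.lo i := by
  have h1 := S.mem_highs.1 hi
  have h4 := S.card_highs_le
  have := S.lastTight_le
  omega

theorem sum_tightSet_greedy : ∑ i ∈ S.tightSet, S.greedy i + S.lastTight =
    S.lastTight * #S.highs + ∑ i ∈ S.highsᶜ, min S.lastTight (S.hi i) := by
  have h := S.sum_greedy_add_card S.tightSet_subset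
  have h1 := S.sum_share_add_residual S.lastTight
  have h2 := S.sum_rank_lt S.share (S.lastTight_le.trans S.card_highs_le_card)
  rw [residual_lastTight, sum_gain] at h1
  rw [card_tightSet] at h
  rw [h, ← h1, ← h2]
  rfl

/-- High indices off the tight set contribute `lastTight` each. This reconciles the square in the
Erdős–Gallai inequality with the product that comes from the clique. -/
theorem sum_tightSet_compl {g : Fin n → ℕ}
    (hg : ∀ i ∈ S.highs \ S.tightSet, S.lastTight ≤ g i) :
    ∑ i ∈ S.tightSetᶜ, min S.lastTight (g i) + S.lastTight * S.lastTight =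
      S.lastTight * #S.highs + ∑ i ∈ S.highsᶜ, min S.lastTight (g i) := by
  rw [S.sum_compl_split, union_eq_right.2 S.tightSet_subset,
    sum_congr rfl fun i hi => min_eq_left (hg i hi), sum_const,
    card_sdiff_of_subset S.tightSet_subset, card_tightSet, smul_eq_mul]
  obtain ⟨t, ht⟩ := Nat.exists_eq_add_of_le S.lastTight_le
  rw [ht, Nat.add_sub_cancel_left]
  ring

/-- The bound of `le_deviation` at `tightSet` is attained: the greedy sequence leaves the intervals
only there and only downwards, and there it uses the whole capacity. -/
theorem deviation_greedy :
    S.deviation S.greedy + S.lastTight * S.lastTight +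
      ∑ i ∈ S.tightSetᶜ, min S.lastTight (S.hi i) = ∑ i ∈ S.tightSet, S.lo i + S.lastTight := by
  have h1 := S.sum_tightSet_greedy
  have h2 := S.sum_tightSet_compl (g := S.hi) fun i hi =>
    (S.lastTight_lt_lo (mem_sdiff.1 hi).1).trans (S.lo_le_hi i)
  have h3 : S.deviation S.greedy + ∑ i ∈ S.tightSet, S.greedy i = ∑ i ∈ S.tightSet, S.lo i := by
    rw [deviation_eq_sum, ← sum_add_sum_compl S.tightSet]
    have h4 : ∑ i ∈ S.tightSetᶜ, ((S.greedy i - S.hi i) + (S.lo i - S.greedy i)) = 0 := by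
      refine sum_eq_zero fun i hi => ?_
      have h5 := S.greedy_le_hi i
      have h6 : S.lo i ≤ S.greedy i := by
        by_cases h : i ∈ S.highs
        · exact (S.greedy_eq_lo h (mem_compl.1 hi)).ge
        · exact S.lo_le_greedy h
      omega
    rw [h4, add_zero, ← sum_add_distrib]
    refine sum_congr rfl fun i hi => ?_
    have h5 := S.greedy_le_hi i
    have h6 := S.greedy_le_lo (S.tightSet_subset hi)
    omega
  omega

theorem egTight_tightSet : EGTight S.greedy S.tightSet := by
  have h1 := S.sum_tightSet_greedy
  have h2 := S.sum_tightSet_compl (g := S.greedy) fun i hi => by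
    rw [S.greedy_eq_lo (mem_sdiff.1 hi).1 (mem_sdiff.1 hi).2]
    exact S.lastTight_lt_lo (mem_sdiff.1 hi).1
  have h3 : ∑ i ∈ S.highsᶜ, min S.lastTight (S.greedy i) =
      ∑ i ∈ S.highsᶜ, min S.lastTight (S.hi i) :=
    sum_congr rfl fun i hi => S.min_greedy S.lastTight_le (mem_compl.1 hi)
  unfold EGTight
  rw [card_tightSet]
  omega

theorem deviation_greedy_le {x : Fin n → ℕ} (hx : IsGraphic x) :
    S.deviation S.greedy ≤ S.deviation x := by
  have h1 := S.deviation_greedy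
  have h2 := S.le_deviation ((isGraphic_iff_egAt.1 hx).2 S.tightSet)
  rw [card_tightSet] at h2
  omega

theorem isMinDeviation_greedy [NeZero n] (h : Even (∑ i, S.greedy i)) :
    S.IsMinDeviation S.greedy :=
  ⟨isGraphic_iff_egAt.2 ⟨h, S.egAt_greedy⟩, fun _ => S.deviation_greedy_le⟩

/-! ### Correction of the parity -/

/-- The first #A positions receive at least as much as A, which takes the whole capacity; so the
residual at #A is zero. -/
theorem card_le_lastTight [NeZero n] {A : Finset (Fin n)} (hA : EGTight S.greedy A)
    (hodd : ¬ Even (∑ i, S.greedy i)) : #A ≤ S.lastTight := by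
  obtain ⟨h1, h2⟩ := S.subset_highs_of_egTight hA hodd
  have h3 := S.sum_share_le h1
  have h4 := S.sum_share_add_residual #A
  exact S.le_lastTight (card_le_card h1) (by omega)

/-- With #A = c + 1, exhausting the capacity gives i a share of at least share c = residual c + gain
c ≥ gain `lastTight`. But the share at `lastTight` is already smaller than that gain, and shares
decrease. -/
theorem lt_of_egTight [NeZero n] {A : Finset (Fin n)} (hA : EGTight S.greedy A)
    (hodd : ¬ Even (∑ i, S.greedy i)) {i : Fin n} (hi : i ∈ A) : S.rank i < S.lastTight := by
  by_contra! hr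
  obtain ⟨h1, h2⟩ := S.subset_highs_of_egTight hA hodd
  have h3 := S.sum_share_le h1
  have h4 := S.sum_share_add_residual #A
  have h5 := S.card_le_lastTight hA hodd
  have hp := S.rank_lt_card_highs.2 (S.mem_highs.1 (h1 hi))
  obtain ⟨c, hc⟩ : ∃ c, #A = c + 1 := ⟨#A - 1, by have := card_pos.2 ⟨i, hi⟩; omega⟩
  have h6 := S.sum_share_le ((erase_subset i A).trans h1)
  have h7 := sum_erase_add A (fun j => S.share (S.rank j)) hi
  rw [card_erase_of_mem hi, hc, Nat.add_sub_cancel] at h6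
  rw [hc] at h2 h3 h4
  have h8 := S.share_add_residual c
  have h9 := S.share_lt le_rfl (hr.trans_lt hp)
  have h10 := S.share_antitone _ _ hr hp
  have h11 := S.gain_antitone (j := c) (k := S.lastTight) (by omega)
  rw [residual_lastTight] at h9
  have h12 := sum_range_succ S.share c
  omega

/-- Otherwise `tightSet` is a tight set that would make the sum even. -/
theorem exists_lastTight_lt (hodd : ¬ Even (∑ i, S.greedy i)) :
    ∃ i, S.lastTight < S.greedy i := by
  by_contra! h
  exact hodd (S.egTight_tightSet.even_sum fun i _ => by rw [card_tightSet]; exact h i)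

theorem sum_update_greedy (i : Fin n) (v : ℕ) :
    ∑ j, Function.update S.greedy i v j + S.greedy i = ∑ j, S.greedy j + v :=
  sum_update_add S.greedy v (mem_univ i) fun _ x => x

theorem deviation_update_greedy (i : Fin n) (v : ℕ) :
    S.deviation (Function.update S.greedy i v) +
        ((S.greedy i - S.hi i) + (S.lo i - S.greedy i)) =
      S.deviation S.greedy + ((v - S.hi i) + (S.lo i - v)) := by
  rw [deviation_eq_sum, deviation_eq_sum]
  exact sum_update_add S.greedy v (mem_univ i) fun j x => (x - S.hi j) + (S.lo j - x)

/-- The parity can be corrected without cost at an index with some freedom. -/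
theorem isMinDeviation_of_free [NeZero n] (hodd : ¬ Even (∑ i, S.greedy i)) {i : Fin n}
    (h1 : S.lastTight ≤ S.rank i) (h2 : S.lo i < S.hi i) (h3 : S.lastTight < S.hi i) :
    S.IsMinDeviation (Function.update S.greedy i
      (if S.greedy i < S.hi i then S.greedy i + 1 else S.greedy i - 1)) := by
  have hlo : S.lo i ≤ S.greedy i := by
    by_cases h : i ∈ S.highs
    · exact (S.greedy_eq_lo h (by rw [mem_tightSet]; omega)).ge
    · exact S.lo_le_greedy h
  have hhi := S.greedy_le_hi i
  split_ifs with h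
  · have hs := S.sum_update_greedy i (S.greedy i + 1)
    have hd := S.deviation_update_greedy i (S.greedy i + 1)
    refine ⟨isGraphic_iff_egAt.2 ⟨?_, ?_⟩, fun x hx => ?_⟩
    · rw [Nat.even_iff] at *; omega
    · refine EGAt.raise S.egAt_greedy fun A hi hA => ?_
      have := S.lt_of_egTight hA hodd hi
      omega
    · have := S.deviation_greedy_le hx
      omega
  · have hs := S.sum_update_greedy i (S.greedy i - 1)
    have hd := S.deviation_update_greedy i (S.greedy i - 1)
    refine ⟨isGraphic_iff_egAt.2 ⟨?_, ?_⟩, fun x hx => ?_⟩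
    · rw [Nat.even_iff] at *; omega
    -- Here the entry equals its upper end, which exceeds the size of every tight set.
    · refine EGAt.lower S.egAt_greedy fun A hi hc hA => ?_
      have := S.card_le_lastTight hA hodd
      omega
    · have := S.deviation_greedy_le hx
      omega

/-- Without freedom the correction of the parity increases the deviation by one. -/
theorem isMinDeviation_of_forced [NeZero n] (hodd : ¬ Even (∑ i, S.greedy i))
    (hf : ∀ i, S.lastTight ≤ S.rank i → S.lo i < S.hi i → S.hi i ≤ S.lastTight) {i : Fin n}
    (hi : S.lastTight < S.greedy i) :
    S.IsMinDeviation (Function.update S.greedy i (S.greedy i - 1)) := by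
  have hs := S.sum_update_greedy i (S.greedy i - 1)
  have hd := S.deviation_update_greedy i (S.greedy i - 1)
  refine ⟨isGraphic_iff_egAt.2 ⟨?_, ?_⟩, fun x hx => ?_⟩
  · rw [Nat.even_iff] at *; omega
  · refine EGAt.lower S.egAt_greedy fun A _ hc hA => ?_
    have := S.card_le_lastTight hA hodd
    omega
  · have h1 := S.deviation_greedy_le hx
    have h2 := S.greedy_le_hi i
    -- If x attained the same bound, its sum would have the parity of the odd greedy sum.
    suffices S.deviation x ≠ S.deviation S.greedy by omega
    intro h3
    have hA : ∀ j ∉ S.tightSet, S.lo j = S.hi j ∨ S.hi j ≤ #S.tightSet := fun j hj => by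
      rw [mem_tightSet, not_lt] at hj
      rw [card_tightSet]
      have := S.lo_le_hi j
      have := hf j hj
      omega
    have h4 := S.deviation_greedy
    rw [← card_tightSet] at h4
    have h5 := S.even_sum_add (S.egAt_greedy S.tightSet) h4.le hA
    obtain ⟨h6, h7⟩ := isGraphic_iff_egAt.1 hx
    have h8 := S.even_sum_add (h7 S.tightSet) (by rw [h3]; exact h4.le) hA
    rw [Nat.even_iff] at *
    omega

end IntervalSeq

/-! ### Program logic for the word RAM -/

namespace Ram

/-- The weakest precondition of a program without loops. -/
def Cmd.wp (W : ℕ) : Cmd → (State → Prop) → State → Prop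
  | .skip, Q, σ => Q σ
  | .assign x e, Q, σ => e.Fits W σ ∧ Q (σ.setReg x (e.val σ))
  | .store a j e, Q, σ => j.Fits W σ ∧ e.Fits W σ ∧ Q (σ.setArr a (j.val σ) (e.val σ))
  | .seq p q, Q, σ => p.wp W (q.wp W Q) σ
  | .cond e p q, Q, σ => e.Fits W σ ∧ (e.val σ ≠ 0 → p.wp W Q σ) ∧ (e.val σ = 0 → q.wp W Q σ)
  | .loop _ _, _, _ => False

/-- A bound for the time of a program without loops. -/
def Cmd.timeBound : Cmd → ℕ
  | .skip => 1
  | .assign _ e => e.cost + 1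
  | .store _ j e => j.cost + e.cost + 1
  | .seq p q => p.timeBound + q.timeBound
  | .cond e p q => e.cost + 1 + p.timeBound + q.timeBound
  | .loop _ _ => 0

/-- Started in `σ`, the program halts within time `T` in a state that satisfies `Q`. -/
def Halts (W : ℕ) (p : Cmd) (T : ℕ) (Q : State → Prop) (σ : State) : Prop :=
  ∃ t σ', Exec W p σ t σ' ∧ t ≤ T ∧ Q σ'

theorem Halts.of_wp {W : ℕ} {p : Cmd} {Q : State → Prop} {σ : State} (h : p.wp W Q σ) :
    Halts W p p.timeBound Q σ := by
  induction p generalizing Q σ with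
  | skip => exact ⟨_, _, .skip σ, le_rfl, h⟩
  | assign x e => exact ⟨_, _, .assign σ x e h.1, le_rfl, h.2⟩
  | store a j e => exact ⟨_, _, .store σ a j e h.1 h.2.1, le_rfl, h.2.2⟩
  | seq p q ihp ihq =>
    obtain ⟨t₁, σ₁, h₁, ht₁, h'⟩ := ihp h
    obtain ⟨t₂, σ₂, h₂, ht₂, hQ⟩ := ihq h'
    exact ⟨_, _, .seq h₁ h₂, Nat.add_le_add ht₁ ht₂, hQ⟩
  | cond e p q ihp ihq =>
    obtain ⟨he, h1, h2⟩ := h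
    simp only [Cmd.timeBound]
    by_cases h0 : e.val σ = 0
    · obtain ⟨t, σ₁, h₁, ht₁, hQ⟩ := ihq (h2 h0)
      exact ⟨_, _, .condFalse he h0 h₁, by omega, hQ⟩
    · obtain ⟨t, σ₁, h₁, ht₁, hQ⟩ := ihp (h1 h0)
      exact ⟨_, _, .condTrue he h0 h₁, by omega, hQ⟩
  -- The precondition of a loop is `False`, so its time bound 0 is never used.
  | loop e p => exact h.elim

theorem Halts.seq {W : ℕ} {p q : Cmd} {T₁ T₂ : ℕ} {R Q : State → Prop} {σ : State}
    (hp : Halts W p T₁ R σ) (hq : ∀ σ', R σ' → Halts W q T₂ Q σ') :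
    Halts W (.seq p q) (T₁ + T₂) Q σ := by
  obtain ⟨t₁, σ₁, h₁, ht₁, h'⟩ := hp
  obtain ⟨t₂, σ₂, h₂, ht₂, hQ⟩ := hq σ₁ h'
  exact ⟨_, _, .seq h₁ h₂, Nat.add_le_add ht₁ ht₂, hQ⟩

/-- The loop that runs while register `1` is below register `x`. -/
def Cmd.upTo (x : ℕ) (p : Cmd) : Cmd := .loop (.op .lt (.reg 1) (.reg x)) p

theorem Halts.upTo {W x N : ℕ} {p : Cmd} (I : ℕ → State → Prop) (hW : N < W) (hW1 : 1 < W)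
    (hI : ∀ k σ, I k σ → σ.reg 1 = k ∧ σ.reg x = N)
    (hp : ∀ k, k < N → ∀ σ, I k σ → p.wp W (I (k + 1)) σ) {σ : State} (h0 : I 0 σ) :
    Halts W (.upTo x p) (N * (p.timeBound + 4) + 4) (I N) σ := by
  suffices h : ∀ d k σ, k + d = N → I k σ →
      Halts W (.upTo x p) (d * (p.timeBound + 4) + 4) (I N) σ from h N 0 σ (by omega) h0
  intro d
  induction d with
  | zero =>
    intro k σ hk hσ
    obtain rfl : k = N := by omega
    obtain ⟨h1, h2⟩ := hI _ _ hσ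
    exact ⟨_, _, .loopDone (by simp [Expr.Fits, Expr.val, Op.eval, h1, h2]; omega)
      (by simp [Expr.val, Op.eval, h1, h2]), by simp [Expr.cost], hσ⟩
  | succ d ih =>
    intro k σ hk hσ
    obtain ⟨h1, h2⟩ := hI _ _ hσ
    have hkN : k < N := by omega
    obtain ⟨t₁, σ₁, e₁, ht₁, hσ₁⟩ := Halts.of_wp (hp k hkN σ hσ)
    obtain ⟨t₂, σ₂, e₂, ht₂, hσ₂⟩ := ih (k + 1) σ₁ (by omega) hσ₁
    refine ⟨_, _, .loopStep ?_ ?_ e₁ e₂, ?_, hσ₂⟩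
    · simp [Expr.Fits, Expr.val, Op.eval, h1, h2, hkN, hW1, hW]; omega
    · simp [Expr.val, Op.eval, h1, h2, hkN]
    · simp only [Expr.cost]
      rw [Nat.succ_mul]
      omega

theorem seqCells_val {n : ℕ} (d : Fin n → ℕ) (j : Fin n) : seqCells d j = d j := by
  simp [seqCells]

theorem card_filter_lt_succ {n : ℕ} (i : Fin n) (p : Fin n → Prop) [DecidablePred p] :
    #{j : Fin n | (j : ℕ) < i + 1 ∧ p j} =
      #{j : Fin n | (j : ℕ) < i ∧ p j} + if p i then 1 else 0 := by
  simp_rw [card_filter]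
  rw [← add_sum_erase _ _ (mem_univ i), ← add_sum_erase (a := i) univ
    (fun j : Fin n => if (j : ℕ) < i ∧ p j then 1 else 0) (mem_univ i)]
  simp only [lt_add_one, true_and, lt_irrefl, false_and, if_false, zero_add]
  rw [add_comm]
  congr 1
  refine sum_congr rfl fun j hj => ?_
  have hne : (j : ℕ) ≠ i := fun h => ne_of_mem_erase hj (Fin.ext h)
  have : (j : ℕ) < i + 1 ↔ (j : ℕ) < i := by omega
  simp only [this]

theorem card_filter_le {n : ℕ} (p : Fin n → Prop) [DecidablePred p] : #{j : Fin n | p j} ≤ n :=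
  (card_le_univ _).trans (by simp)

end Ram

/-! ### The program, its invariants, and the counting and level passes -/

namespace Ram

local infixr:60 " ;; " => Cmd.seq

/-- Increase a register by one. -/
abbrev Cmd.incr (x : ℕ) : Cmd := .assign x (.op .add (.reg x) (.const 1))

/-- Increase an array cell by one. -/
abbrev Cmd.incrCell (a : ℕ) (j : Expr) : Cmd := .store a j (.op .add (.get a j) (.const 1))

/-- Count the lower ends into array `3` and the upper ends into array `4`. -/
def countBody : Cmd :=
  .incrCell 3 (.get 0 (.reg 1)) ;; .incrCell 4 (.get 1 (.reg 1)) ;; .incr 1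

/-- Put the number of lower ends above `v` into cell `v` of array `5` and the level into
register `4`. -/
def levelBody : Cmd :=
  .assign 2 (.op .add (.reg 2) (.get 3 (.reg 1))) ;;
  .store 5 (.reg 1) (.op .sub (.reg 0) (.reg 2)) ;;
  .cond (.op .lt (.reg 1) (.op .sub (.reg 0) (.reg 3))) (.assign 4 (.reg 1)) .skip ;;
  .assign 3 (.op .add (.reg 3) (.get 4 (.reg 1))) ;;
  .incr 1

/-- Sort the indices into array `6`, count the high ones in register `5`, and treat the others:
count their upper ends in array `7` and write their output. -/
def sortBody : Cmd :=
  .assign 11 (.get 5 (.get 0 (.reg 1))) ;;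
  .store 6 (.reg 11) (.reg 1) ;;
  .incrCell 5 (.get 0 (.reg 1)) ;;
  .cond (.op .lt (.reg 4) (.get 0 (.reg 1)))
    (.incr 5)
    (.incrCell 7 (.get 1 (.reg 1)) ;;
     .cond (.op .lt (.get 1 (.reg 1)) (.reg 4))
       (.store 2 (.reg 1) (.get 1 (.reg 1)))
       (.store 2 (.reg 1) (.reg 4))) ;;
  .incr 1

/-- The greedy distribution: register `12` holds the gain, register `6` the residual and
register `7` the last tight position. -/
def greedyBody : Cmd :=
  .assign 12 (.op .sub (.reg 12) (.get 7 (.reg 1))) ;;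
  .assign 6 (.op .add (.reg 6) (.reg 12)) ;;
  .assign 11 (.op .sub (.op .add (.get 0 (.get 6 (.reg 1))) (.const 1)) (.reg 5)) ;;
  .cond (.op .lt (.reg 6) (.reg 11)) (.assign 11 (.reg 6)) .skip ;;
  .assign 6 (.op .sub (.reg 6) (.reg 11)) ;;
  .store 2 (.get 6 (.reg 1)) (.op .add (.op .sub (.reg 5) (.const 1)) (.reg 11)) ;;
  .incr 1 ;;
  .cond (.reg 6) .skip (.assign 7 (.reg 1))

/-- Compute the parity of the output in register `8` and search for indices at which it can be
corrected. -/
def searchBody : Cmd :=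
  .assign 11 (.get 6 (.reg 1)) ;;
  .assign 8 (.op .mod (.op .add (.reg 8) (.get 2 (.reg 11))) (.const 2)) ;;
  .cond (.op .lt (.reg 1) (.reg 7)) .skip
    (.cond (.op .lt (.get 0 (.reg 11)) (.get 1 (.reg 11)))
      (.cond (.op .lt (.reg 7) (.get 1 (.reg 11)))
        (.assign 9 (.op .add (.reg 11) (.const 1))) .skip) .skip) ;;
  .cond (.op .lt (.reg 7) (.get 2 (.reg 11)))
    (.assign 10 (.op .add (.reg 11) (.const 1))) .skip ;;
  .incr 1

/-- Correct the parity of the output. -/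
def correct : Cmd :=
  .cond (.reg 8)
    (.cond (.reg 9)
      (.assign 11 (.op .sub (.reg 9) (.const 1)) ;;
       .cond (.op .lt (.get 2 (.reg 11)) (.get 1 (.reg 11)))
        (.incrCell 2 (.reg 11))
        (.store 2 (.reg 11) (.op .sub (.get 2 (.reg 11)) (.const 1))))
      (.assign 11 (.op .sub (.reg 10) (.const 1)) ;;
       .store 2 (.reg 11) (.op .sub (.get 2 (.reg 11)) (.const 1))))
    .skip

/-- Reset the loop counter. -/
abbrev reset : Cmd := .assign 1 (.const 0)

/-- Computes a graphic sequence of minimum deviation. -/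
def minDeviation : Cmd :=
  .upTo 0 countBody ;;
  reset ;;
  .upTo 0 levelBody ;;
  reset ;;
  .upTo 0 sortBody ;;
  (reset ;; .assign 12 (.op .sub (.reg 0) (.reg 5))) ;;
  .upTo 5 greedyBody ;;
  reset ;;
  .upTo 0 searchBody ;;
  correct

variable {n : ℕ} (S : IntervalSeq n)

/-- The input is present. -/
structure Input (σ : State) : Prop where
  len : σ.reg 0 = n
  lo : ∀ j : Fin n, σ.arr 0 j = S.lo j
  hi : ∀ j : Fin n, σ.arr 1 j = S.hi j

/-- The state after counting the first `k` indices. -/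
structure CountInv (k : ℕ) (σ : State) : Prop extends Input S σ where
  idx : σ.reg 1 = k
  cntLo : ∀ v, σ.arr 3 v = #{j : Fin n | (j : ℕ) < k ∧ S.lo j = v}
  cntHi : ∀ v, σ.arr 4 v = #{j : Fin n | (j : ℕ) < k ∧ S.hi j = v}
  zeroReg : ∀ x, 2 ≤ x → σ.reg x = 0
  zeroArr : ∀ j, σ.arr 7 j = 0

/-- The state after treating the first `k` values in the search for the level. -/
structure LevelInv (k : ℕ) (σ : State) : Prop extends Input S σ where
  idx : σ.reg 1 = k
  cntLo : ∀ v, σ.arr 3 v = #{j : Fin n | S.lo j = v}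
  cntHi : ∀ v, σ.arr 4 v = #{j : Fin n | S.hi j = v}
  sumLo : σ.reg 2 = #{j : Fin n | S.lo j < k}
  sumHi : σ.reg 3 = #{j : Fin n | S.hi j < k}
  start : ∀ v < k, σ.arr 5 v = #{j : Fin n | v < S.lo j}
  level : σ.reg 4 < #{j : Fin n | σ.reg 4 ≤ S.hi j}
  le_level : ∀ v < k, v < #{j : Fin n | v ≤ S.hi j} → v ≤ σ.reg 4
  zeroReg : ∀ x, 5 ≤ x → σ.reg x = 0
  zeroArr : ∀ j, σ.arr 7 j = 0

/-- The state after sorting the first `k` indices. -/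
structure SortInv (k : ℕ) (σ : State) : Prop extends Input S σ where
  idx : σ.reg 1 = k
  level : σ.reg 4 = S.level
  start : ∀ v < n, σ.arr 5 v = #{j : Fin n | v < S.lo j} + #{j : Fin n | (j : ℕ) < k ∧ S.lo j = v}
  ord : ∀ j : Fin n, (j : ℕ) < k → σ.arr 6 (S.rank j) = j
  highs : σ.reg 5 = #{j : Fin n | (j : ℕ) < k ∧ S.level < S.lo j}
  cnt : ∀ v, σ.arr 7 v = #{j : Fin n | (j : ℕ) < k ∧ (S.lo j ≤ S.level ∧ S.hi j = v)}
  out : ∀ j : Fin n, (j : ℕ) < k → S.lo j ≤ S.level → σ.arr 2 j = S.greedy j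
  zeroReg : ∀ x, 6 ≤ x → x ≠ 11 → σ.reg x = 0

/-- The state after serving the first `k` positions. -/
structure GreedyInv (k : ℕ) (σ : State) : Prop extends Input S σ where
  idx : σ.reg 1 = k
  ord : ∀ j : Fin n, σ.arr 6 (S.rank j) = j
  highs : σ.reg 5 = #S.highs
  cnt : ∀ v, σ.arr 7 v = #{j : Fin n | S.lo j ≤ S.level ∧ S.hi j = v}
  gain : σ.reg 12 = #{j : Fin n | S.lo j ≤ S.level ∧ k ≤ S.hi j}
  residual : σ.reg 6 = S.residual k
  tight : σ.reg 7 = Nat.findGreatest (fun k => S.residual k = 0) k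
  out : ∀ j : Fin n, S.lo j ≤ S.level ∨ S.rank j < k → σ.arr 2 j = S.greedy j
  zeroReg : ∀ x, 8 ≤ x → x < 11 → σ.reg x = 0

/-- The indices at which the parity can be corrected without cost. -/
def Free (j : Fin n) : Prop := S.lastTight ≤ S.rank j ∧ S.lo j < S.hi j ∧ S.lastTight < S.hi j

/-- The state after inspecting the first `k` positions. -/
structure SearchInv (k : ℕ) (σ : State) : Prop extends Input S σ where
  idx : σ.reg 1 = k
  ord : ∀ j : Fin n, σ.arr 6 (S.rank j) = j
  tight : σ.reg 7 = S.lastTight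
  out : ∀ j : Fin n, σ.arr 2 j = S.greedy j
  parity : σ.reg 8 = (∑ j with S.rank j < k, S.greedy j) % 2
  free : σ.reg 9 ≠ 0 → ∃ j : Fin n, σ.reg 9 = j + 1 ∧ Free S j
  not_free : σ.reg 9 = 0 → ∀ j, S.rank j < k → ¬ Free S j
  forced : σ.reg 10 ≠ 0 → ∃ j : Fin n, σ.reg 10 = j + 1 ∧ S.lastTight < S.greedy j
  not_forced : σ.reg 10 = 0 → ∀ j, S.rank j < k → ¬ S.lastTight < S.greedy j

variable {S} {W : ℕ}

theorem countInv_input : CountInv S 0 (inputState S) := by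
  constructor
  · constructor <;> simp [inputState, seqCells_val]
  all_goals simp [inputState]
  omega

theorem wp_countBody (hW : n * n + n + 2 < W) {k : ℕ} (hk : k < n) {σ : State}
    (h : CountInv S k σ) : countBody.wp W (CountInv S (k + 1)) σ := by
  obtain ⟨j, rfl⟩ : ∃ j : Fin n, (j : ℕ) = k := ⟨⟨k, hk⟩, rfl⟩
  have h1 := h.idx
  have h2 := h.lo j
  have h3 := h.hi j
  have h4 := card_filter_le (fun i : Fin n => (i : ℕ) < j ∧ S.lo i = S.lo j)
  have h5 := card_filter_le (fun i : Fin n => (i : ℕ) < j ∧ S.hi i = S.hi j)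
  have h6 := S.hi_lt j
  have h7 := S.lo_le_hi j
  simp only [countBody, h1, h2, h3, h.cntLo, h.cntHi, Cmd.wp, Expr.Fits, Expr.val, Op.eval,
    State.setReg, State.setArr, Function.update_apply, reduceIte, Nat.reduceEqDiff,
    OfNat.ofNat_ne_zero, OfNat.zero_ne_ofNat, OfNat.ofNat_ne_one, OfNat.one_ne_ofNat, one_ne_zero,
    zero_ne_one, ne_eq, not_true_eq_false, not_false_eq_true, forall_const, false_implies,
    IsEmpty.forall_iff, and_true, true_and]
  repeat refine ⟨by omega, ?_⟩
  refine ⟨⟨?_, ?_, ?_⟩, ?_, ?_, ?_, ?_, ?_⟩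
  · simpa using h.len
  · simpa using h.lo
  · simpa using h.hi
  · simp
  · intro v
    simp only [Function.update_apply, reduceIte, Nat.reduceEqDiff, card_filter_lt_succ, h.cntLo]
    by_cases hv : v = S.lo j
    · simp [hv]
    · simp [hv, Ne.symm hv]
  · intro v
    simp only [Function.update_apply, reduceIte, card_filter_lt_succ, h.cntHi]
    by_cases hv : v = S.hi j
    · simp [hv]
    · simp [hv, Ne.symm hv]
  · intro x hx
    simp [Function.update_apply, show x ≠ 1 by omega, h.zeroReg x hx]
  · simp [h.zeroArr]

theorem card_lt_succ (f : Fin n → ℕ) (k : ℕ) :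
    #{i | f i < k + 1} = #{i | f i < k} + #{i | f i = k} := by
  rw [← card_union_of_disjoint (disjoint_filter.2 fun i _ h => by omega), ← filter_or]
  congr 1
  ext i
  simp only [mem_filter_univ]
  omega

theorem card_lt_add_card_le (f : Fin n → ℕ) (k : ℕ) : #{i | f i < k} + #{i | k ≤ f i} = n := by
  simp_rw [← not_lt]
  rw [card_filter_add_card_filter_not]
  simp

theorem levelInv_of_countInv (hn : 0 < n) {σ : State} (h : CountInv S n σ) :
    LevelInv S 0 (σ.setReg 1 0) := by
  refine ⟨⟨?_, ?_, ?_⟩, ?_, ?_, ?_, ?_, ?_, ?_, ?_, ?_, ?_, ?_⟩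
  · simpa [State.setReg] using h.len
  · simpa [State.setReg] using h.lo
  · simpa [State.setReg] using h.hi
  · simp [State.setReg]
  · simpa [State.setReg] using h.cntLo
  · simpa [State.setReg] using h.cntHi
  · simpa [State.setReg] using h.zeroReg 2 le_rfl
  · simpa [State.setReg] using h.zeroReg 3 (by omega)
  · simp
  · simpa [State.setReg, h.zeroReg 4 (by omega)] using hn
  · simp
  · intro x hx
    simp [State.setReg, Function.update_apply, show x ≠ 1 by omega, h.zeroReg x (by omega)]
  · simpa [State.setReg] using h.zeroArr

theorem wp_levelBody (hW : n * n + n + 2 < W) {k : ℕ} (hk : k < n) {σ : State}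
    (h : LevelInv S k σ) : levelBody.wp W (LevelInv S (k + 1)) σ := by
  have h1 := h.idx
  have h2 := h.len
  have h3 := card_lt_succ S.lo k
  have h4 := card_lt_succ S.hi k
  have h5 := card_lt_add_card_le S.lo (k + 1)
  have h6 := card_lt_add_card_le S.hi k
  have h7 := card_lt_add_card_le S.hi (k + 1)
  -- The difference is the number of upper ends that are at least k, so this is the condition that
  -- defines the level.
  by_cases hc : k < n - #{i | S.hi i < k}
  · simp only [levelBody, h1, h2, h.cntLo, h.cntHi, h.sumLo, h.sumHi, hc, Cmd.wp, Expr.Fits,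
      Expr.val, Op.eval, State.setReg, State.setArr, Function.update_apply, reduceIte,
      Nat.reduceEqDiff, OfNat.ofNat_ne_zero, OfNat.zero_ne_ofNat, OfNat.ofNat_ne_one,
      OfNat.one_ne_ofNat, one_ne_zero, zero_ne_one, ne_eq, not_true_eq_false, not_false_eq_true,
      forall_const, false_implies, IsEmpty.forall_iff, and_true, true_and]
    repeat refine ⟨by omega, ?_⟩
    refine ⟨⟨?_, ?_, ?_⟩, ?_, ?_, ?_, ?_, ?_, ?_, ?_, ?_, ?_, ?_⟩
    · simpa using h.len
    · simpa using h.lo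
    · simpa using h.hi
    · simp
    · simpa using h.cntLo
    · simpa using h.cntHi
    · simpa using h3.symm
    · simpa using h4.symm
    · intro v hv
      have := h.start v
      by_cases hvk : v = k
      · subst hvk
        simp only [Function.update_apply, reduceIte]
        rw [← h3]
        exact Nat.sub_eq_of_eq_add (by rw [add_comm]; exact h5.symm)
      · simpa [Function.update_apply, hvk] using this (by omega)
    · simp only [Function.update_apply, reduceIte, Nat.reduceEqDiff, OfNat.ofNat_ne_one]
      omega
    · intro v hv _
      simp only [Function.update_apply, reduceIte, Nat.reduceEqDiff, OfNat.ofNat_ne_one]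
      omega
    · intro x hx
      simp [Function.update_apply, show x ≠ 1 by omega, show x ≠ 2 by omega, show x ≠ 3 by omega,
        show x ≠ 4 by omega, h.zeroReg x (by omega)]
    · simpa using h.zeroArr
  · simp only [levelBody, h1, h2, h.cntLo, h.cntHi, h.sumLo, h.sumHi, hc, Cmd.wp, Expr.Fits,
      Expr.val, Op.eval, State.setReg, State.setArr, Function.update_apply, reduceIte,
      Nat.reduceEqDiff, OfNat.ofNat_ne_zero, OfNat.zero_ne_ofNat, OfNat.ofNat_ne_one,
      OfNat.one_ne_ofNat, one_ne_zero, zero_ne_one, ne_eq, not_true_eq_false, not_false_eq_true,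
      forall_const, false_implies, IsEmpty.forall_iff, and_true, true_and]
    repeat refine ⟨by omega, ?_⟩
    refine ⟨⟨?_, ?_, ?_⟩, ?_, ?_, ?_, ?_, ?_, ?_, ?_, ?_, ?_, ?_⟩
    · simpa using h.len
    · simpa using h.lo
    · simpa using h.hi
    · simp
    · simpa using h.cntLo
    · simpa using h.cntHi
    · simpa using h3.symm
    · simpa using h4.symm
    · intro v hv
      have := h.start v
      by_cases hvk : v = k
      · subst hvk
        simp only [Function.update_apply, reduceIte]
        rw [← h3]
        exact Nat.sub_eq_of_eq_add (by rw [add_comm]; exact h5.symm)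
      · simpa [Function.update_apply, hvk] using this (by omega)
    · simpa using h.level
    · intro v hv hv'
      simp only [Function.update_apply, reduceIte, Nat.reduceEqDiff, OfNat.ofNat_ne_one]
      refine h.le_level v ?_ hv'
      by_contra hvk
      obtain rfl : v = k := by omega
      omega
    · intro x hx
      simp [Function.update_apply, show x ≠ 1 by omega, show x ≠ 2 by omega, show x ≠ 3 by omega,
        h.zeroReg x (by omega)]
    · simpa using h.zeroArr

theorem sortInv_of_levelInv [NeZero n] {σ : State} (h : LevelInv S n σ) :
    SortInv S 0 (σ.setReg 1 0) := by
  refine ⟨⟨?_, ?_, ?_⟩, ?_, ?_, ?_, ?_, ?_, ?_, ?_, ?_⟩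
  · simpa [State.setReg] using h.len
  · simpa [State.setReg] using h.lo
  · simpa [State.setReg] using h.hi
  · simp [State.setReg]
  -- The level is below n, so inspecting the values below n is enough.
  · have h1 := S.level_lt_card
    exact le_antisymm (S.le_level h.level)
      (h.le_level _ (h1.trans_le (card_filter_le _)) h1)
  · intro v hv
    simpa [State.setReg] using h.start v hv
  · simp
  · simpa [State.setReg] using h.zeroReg 5 le_rfl
  · simpa [State.setReg] using h.zeroArr
  · simp
  · intro x hx _
    simp [State.setReg, Function.update_apply, show x ≠ 1 by omega, h.zeroReg x (by omega)]

/-- Correctness of the counting sort: the next free cell for a value is the number of larger lower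
ends plus the number of equal ones already placed. -/
theorem rank_eq (j : Fin n) :
    S.rank j = #{i | S.lo j < S.lo i} + #{i : Fin n | (i : ℕ) < j ∧ S.lo i = S.lo j} := by
  rw [← card_union_of_disjoint (disjoint_filter.2 fun i _ h => by omega), ← filter_or]
  refine congrArg card (filter_congr fun i _ => ?_)
  rw [Fin.lt_def]
  tauto

end Ram

/-! ### The sorting pass and the greedy pass -/

namespace Ram

variable {n : ℕ} {S : IntervalSeq n} {W : ℕ}

theorem sortInv_start {k : Fin n} {f : ℕ → ℕ}
    (h : ∀ v < n, f v = #{j | v < S.lo j} + #{j : Fin n | (j : ℕ) < k ∧ S.lo j = v}) (v : ℕ)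
    (hv : v < n) :
    (if v = S.lo k then S.rank k + 1 else f v) =
      #{j | v < S.lo j} + #{j : Fin n | (j : ℕ) < k + 1 ∧ S.lo j = v} := by
  rw [card_filter_lt_succ]
  by_cases hvk : v = S.lo k
  · simp only [hvk, reduceIte, rank_eq]
    omega
  · simp only [hvk, Ne.symm hvk, reduceIte, h v hv, add_zero]

theorem sortInv_ord {k : Fin n} {f : ℕ → ℕ} (h : ∀ j : Fin n, (j : ℕ) < k → f (S.rank j) = j)
    (j : Fin n) (hj : (j : ℕ) < k + 1) :
    (if S.rank j = S.rank k then (k : ℕ) else f (S.rank j)) = j := by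
  by_cases hjk : j = k
  · simp [hjk]
  · rw [if_neg fun e => hjk (S.rank_injective e)]
    refine h j ?_
    have : (j : ℕ) ≠ k := fun e => hjk (Fin.ext e)
    omega

theorem wp_sortBody (hW : n * n + n + 2 < W) {k : ℕ} (hk : k < n) {σ : State}
    (h : SortInv S k σ) : sortBody.wp W (SortInv S (k + 1)) σ := by
  obtain ⟨j, rfl⟩ : ∃ j : Fin n, (j : ℕ) = k := ⟨⟨k, hk⟩, rfl⟩
  have h1 := h.idx
  have h2 := h.lo j
  have h3 := h.hi j
  have h4 : σ.arr 5 (S.lo j) = S.rank j := by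
    rw [h.start _ ((S.lo_le_hi j).trans_lt (S.hi_lt j)), rank_eq]
  have h5 := h.level
  have h6 := S.hi_lt j
  have h7 := S.lo_le_hi j
  have h8 := S.rank_lt j
  have h9 := card_filter_le (fun i : Fin n => (i : ℕ) < j ∧ S.level < S.lo i)
  have h10 := card_filter_le (fun i : Fin n => (i : ℕ) < j ∧ (S.lo i ≤ S.level ∧ S.hi i = S.hi j))
  have h11 : S.level ≤ n := Nat.findGreatest_le _
  by_cases hc : S.level < S.lo j
  · simp only [sortBody, h1, h2, h3, h4, h5, h.highs, hc, Cmd.wp, Expr.Fits, Expr.val, Op.eval,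
      State.setReg, State.setArr, Function.update_apply, reduceIte, Nat.reduceEqDiff,
      OfNat.ofNat_ne_zero, OfNat.zero_ne_ofNat, OfNat.ofNat_ne_one, OfNat.one_ne_ofNat, one_ne_zero,
      zero_ne_one, ne_eq, not_true_eq_false, not_false_eq_true, forall_const, false_implies,
      IsEmpty.forall_iff, and_true, true_and]
    repeat refine ⟨by omega, ?_⟩
    refine ⟨⟨?_, ?_, ?_⟩, ?_, ?_, ?_, ?_, ?_, ?_, ?_, ?_⟩
    · simpa using h.len
    · simpa using h.lo
    · simpa using h.hi
    · simp
    · simpa using h5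
    · simpa [Function.update_apply] using sortInv_start h.start
    · simpa [Function.update_apply] using sortInv_ord h.ord
    · simp only [Function.update_apply, reduceIte, card_filter_lt_succ, hc]
      simp
    · intro v
      simp only [Function.update_apply, card_filter_lt_succ, not_le.2 hc]
      simpa using h.cnt v
    · intro i hi hi'
      have hij : (i : ℕ) ≠ j := by rintro e; rw [Fin.ext e] at hi'; omega
      simpa using h.out i (by omega) hi'
    · intro x hx hx'
      simp [Function.update_apply, show x ≠ 1 by omega, show x ≠ 5 by omega, hx',
        h.zeroReg x hx hx']
  · by_cases hc' : S.hi j < S.level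
    · simp only [sortBody, h1, h2, h3, h4, h5, h.cnt, hc, hc', Cmd.wp, Expr.Fits, Expr.val, Op.eval,
        State.setReg, State.setArr, Function.update_apply, reduceIte, Nat.reduceEqDiff,
        OfNat.ofNat_ne_zero, OfNat.zero_ne_ofNat, OfNat.ofNat_ne_one, OfNat.one_ne_ofNat,
        one_ne_zero, zero_ne_one, ne_eq, not_true_eq_false, not_false_eq_true, forall_const,
        false_implies, IsEmpty.forall_iff, and_true, true_and]
      repeat refine ⟨by omega, ?_⟩
      refine ⟨⟨?_, ?_, ?_⟩, ?_, ?_, ?_, ?_, ?_, ?_, ?_, ?_⟩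
      · simpa using h.len
      · simpa using h.lo
      · simpa using h.hi
      · simp
      · simpa using h5
      · simpa [Function.update_apply] using sortInv_start h.start
      · simpa [Function.update_apply] using sortInv_ord h.ord
      · simp only [Function.update_apply, reduceIte, card_filter_lt_succ, hc]
        simpa using h.highs
      · intro v
        simp only [Function.update_apply, card_filter_lt_succ, not_lt.1 hc]
        by_cases hv : v = S.hi j
        · simp [hv, ← h.cnt]
        · simpa [hv, Ne.symm hv] using h.cnt v
      · intro i hi hi'
        simp only [Function.update_apply, reduceIte]
        split_ifs with hij
        · obtain rfl := Fin.ext hij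
          rw [IntervalSeq.greedy, if_neg hc, min_eq_left hc'.le]
        · exact h.out i (by omega) hi'
      · intro x hx hx'
        simp [Function.update_apply, show x ≠ 1 by omega, hx', h.zeroReg x hx hx']
    · simp only [sortBody, h1, h2, h3, h4, h5, h.cnt, hc, hc', Cmd.wp, Expr.Fits, Expr.val, Op.eval,
        State.setReg, State.setArr, Function.update_apply, reduceIte, Nat.reduceEqDiff,
        OfNat.ofNat_ne_zero, OfNat.zero_ne_ofNat, OfNat.ofNat_ne_one, OfNat.one_ne_ofNat,
        one_ne_zero, zero_ne_one, ne_eq, not_true_eq_false, not_false_eq_true, forall_const,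
        false_implies, IsEmpty.forall_iff, and_true, true_and]
      repeat refine ⟨by omega, ?_⟩
      refine ⟨⟨?_, ?_, ?_⟩, ?_, ?_, ?_, ?_, ?_, ?_, ?_, ?_⟩
      · simpa using h.len
      · simpa using h.lo
      · simpa using h.hi
      · simp
      · simpa using h5
      · simpa [Function.update_apply] using sortInv_start h.start
      · simpa [Function.update_apply] using sortInv_ord h.ord
      · simp only [Function.update_apply, reduceIte, card_filter_lt_succ, hc]
        simpa using h.highs
      · intro v
        simp only [Function.update_apply, card_filter_lt_succ, not_lt.1 hc]
        by_cases hv : v = S.hi j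
        · simp [hv, ← h.cnt]
        · simpa [hv, Ne.symm hv] using h.cnt v
      · intro i hi hi'
        simp only [Function.update_apply, reduceIte]
        split_ifs with hij
        · obtain rfl := Fin.ext hij
          rw [IntervalSeq.greedy, if_neg hc, min_eq_right (not_lt.1 hc')]
        · exact h.out i (by omega) hi'
      · intro x hx hx'
        simp [Function.update_apply, show x ≠ 1 by omega, hx', h.zeroReg x hx hx']

theorem greedyInv_of_sortInv {σ : State} (h : SortInv S n σ) :
    GreedyInv S 0 ((σ.setReg 1 0).setReg 12 (n - σ.reg 5)) := by
  have h1 : σ.reg 5 = #S.highs := by simpa [IntervalSeq.highs] using h.highs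
  refine ⟨⟨?_, ?_, ?_⟩, ?_, ?_, ?_, ?_, ?_, ?_, ?_, ?_, ?_⟩
  · simpa [State.setReg] using h.len
  · simpa [State.setReg] using h.lo
  · simpa [State.setReg] using h.hi
  · simp [State.setReg]
  · simpa [State.setReg] using h.ord
  · simpa [State.setReg] using h1
  · simpa [State.setReg] using h.cnt
  -- At k = 0 the condition on upper ends is void, so the gain counter starts at the number of
  -- indices that are not high.
  · have h2 := card_lt_add_card_le S.lo (S.level + 1)
    have h3 : #{j | S.lo j ≤ S.level ∧ 0 ≤ S.hi j} = #{j | S.lo j < S.level + 1} :=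
      congrArg card (filter_congr fun j _ => by omega)
    have h4 : #S.highs = #{j | S.level + 1 ≤ S.lo j} := rfl
    simp only [State.setReg, Function.update_apply, reduceIte, h1]
    omega
  · simpa [State.setReg, IntervalSeq.residual] using h.zeroReg 6 le_rfl (by omega)
  · simpa [State.setReg] using h.zeroReg 7 (by omega) (by omega)
  · intro j hj
    simpa [State.setReg] using h.out j j.2 (by omega)
  · intro x hx hx'
    simp [State.setReg, Function.update_apply, show x ≠ 1 by omega, show x ≠ 12 by omega,
      h.zeroReg x (by omega) (by omega)]

/-- Accumulated capacity can be quadratic, hence the n² in the word bound. -/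
theorem residual_add_gain_le {k : ℕ} (hk : k < n) : S.residual k + S.gain k ≤ n * n := by
  have h1 := S.sum_share_add_residual k
  have h2 : ∑ j ∈ range (k + 1), S.gain j ≤ #(range (k + 1)) • n :=
    sum_le_card_nsmul _ _ _ fun j _ => card_filter_le _
  rw [sum_range_succ, card_range, smul_eq_mul] at h2
  have h3 : (k + 1) * n ≤ n * n := Nat.mul_le_mul_right _ hk
  omega

theorem card_sub_eq_gain (k : ℕ) :
    #{j | S.lo j ≤ S.level ∧ k ≤ S.hi j} - #{j | S.lo j ≤ S.level ∧ S.hi j = k} = S.gain k := by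
  refine Nat.sub_eq_of_eq_add ?_
  rw [IntervalSeq.gain, ← card_union_of_disjoint (disjoint_filter.2 fun i _ h => by omega),
    ← filter_or]
  exact congrArg card (filter_congr fun i _ => by omega)

/-- One argument for all branches of the loop body, which differ only in how the final registers
were obtained. -/
theorem GreedyInv.step {j : Fin n} {σ σ' : State} (h : GreedyInv S (S.rank j) σ)
    (hj : S.level < S.lo j) (hr : ∀ x, x ∈ [0, 5, 8, 9, 10] → σ'.reg x = σ.reg x)
    (ha : ∀ a, a ≠ 2 → σ'.arr a = σ.arr a)
    (h1 : σ'.reg 1 = S.rank j + 1) (h12 : σ'.reg 12 = S.gain (S.rank j))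
    (h6 : σ'.reg 6 = S.residual (S.rank j + 1))
    (h7 : σ'.reg 7 = if S.residual (S.rank j + 1) = 0 then S.rank j + 1 else σ.reg 7)
    (h2 : σ'.arr 2 = Function.update (σ.arr 2) j (#S.highs - 1 + S.share (S.rank j))) :
    GreedyInv S (S.rank j + 1) σ' where
  len := (hr 0 (by simp)).trans h.len
  lo := ha 0 (by omega) ▸ h.lo
  hi := ha 1 (by omega) ▸ h.hi
  idx := h1
  ord := ha 6 (by omega) ▸ h.ord
  highs := (hr 5 (by simp)).trans h.highs
  cnt := ha 7 (by omega) ▸ h.cnt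
  gain := h12
  residual := h6
  tight := by rw [h7, Nat.findGreatest_succ, h.tight]
  out i hi := by
    rw [h2, Function.update_apply]
    split_ifs with hij
    · obtain rfl := Fin.ext hij
      rw [IntervalSeq.greedy, if_pos hj]
    · refine h.out i (hi.imp_right fun hr => ?_)
      have : S.rank i ≠ S.rank j := fun e => hij (congrArg Fin.val (S.rank_injective e))
      omega
  zeroReg x hx hx' := by
    rw [hr x (by interval_cases x <;> simp), h.zeroReg x hx hx']

theorem wp_greedyBody (hW : n * n + n + 2 < W) {k : ℕ} (hk : k < #S.highs) {σ : State}
    (h : GreedyInv S k σ) : greedyBody.wp W (GreedyInv S (k + 1)) σ := by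
  have hkn := hk.trans_le S.card_highs_le_card
  obtain ⟨j, rfl⟩ := S.exists_rank_eq hkn
  have h0 : S.level < S.lo j := S.rank_lt_card_highs.1 hk
  have h1 := h.idx
  have h2 := h.lo j
  have h3 := h.ord j
  have h4 := h.highs
  have h5 := card_sub_eq_gain (S := S) (S.rank j)
  have h6 := residual_add_gain_le (S := S) hkn
  have h7 := S.lo_le_hi j
  have h8 := S.hi_lt j
  have h9 := S.card_highs_le_card
  have h10 : S.lo j + 1 - #S.highs = S.demand (S.rank j) := by
    rw [IntervalSeq.demand, IntervalSeq.sortedLo_rank]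
  have h11 := card_filter_le (fun i => S.lo i ≤ S.level ∧ S.rank j ≤ S.hi i)
  have h12 := card_filter_le (fun i => S.lo i ≤ S.level ∧ S.hi i = S.rank j)
  have h13 : S.demand (S.rank j) ≤ n := by omega
  have hj := j.2
  have hres : ∀ v, v = S.share (S.rank j) →
      S.residual (S.rank j) + S.gain (S.rank j) - v = S.residual (S.rank j + 1) := by
    rintro v rfl
    have := S.share_add_residual (S.rank j)
    omega
  have hle := S.share_add_residual (S.rank j)
  by_cases hc : S.residual (S.rank j) + S.gain (S.rank j) < S.demand (S.rank j)
  · have hv : S.residual (S.rank j) + S.gain (S.rank j) = S.share (S.rank j) := by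
      rw [IntervalSeq.share]; omega
    have hr := hres _ hv
    by_cases hz : S.residual (S.rank j + 1) = 0
    · simp only [greedyBody, h1, h2, h3, h4, h.cnt, h.gain, h.residual, h5, h10, hc, hr, hz, Cmd.wp,
        Expr.Fits, Expr.val, Op.eval, State.setReg, State.setArr, Function.update_apply, reduceIte,
        Nat.reduceEqDiff, OfNat.ofNat_ne_zero, OfNat.zero_ne_ofNat, OfNat.ofNat_ne_one,
        OfNat.one_ne_ofNat, one_ne_zero, zero_ne_one, ne_eq, not_true_eq_false, not_false_eq_true,
        forall_const, false_implies, IsEmpty.forall_iff, and_true, true_and]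
      repeat refine ⟨by omega, ?_⟩
      refine h.step h0 ?_ ?_ rfl rfl ?_ ?_ ?_
      · simp
      · intro a ha
        simp [ha]
      · simp [hz]
      · simp [hz]
      · simp [hv]
    · simp only [greedyBody, h1, h2, h3, h4, h.cnt, h.gain, h.residual, h5, h10, hc, hr, hz, Cmd.wp,
        Expr.Fits, Expr.val, Op.eval, State.setReg, State.setArr, Function.update_apply, reduceIte,
        Nat.reduceEqDiff, OfNat.ofNat_ne_zero, OfNat.zero_ne_ofNat, OfNat.ofNat_ne_one,
        OfNat.one_ne_ofNat, one_ne_zero, zero_ne_one, ne_eq, not_true_eq_false, not_false_eq_true,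
        forall_const, false_implies, IsEmpty.forall_iff, and_true, true_and]
      repeat refine ⟨by omega, ?_⟩
      refine h.step h0 ?_ ?_ rfl rfl ?_ ?_ ?_
      · simp
      · intro a ha
        simp [ha]
      · simp [hz]
      · simp [hz]
      · simp [hv]
  · have hv : S.demand (S.rank j) = S.share (S.rank j) := by
      rw [IntervalSeq.share]; omega
    have hr := hres _ hv
    by_cases hz : S.residual (S.rank j + 1) = 0
    · simp only [greedyBody, h1, h2, h3, h4, h.cnt, h.gain, h.residual, h5, h10, hc, hr, hz, Cmd.wp,
        Expr.Fits, Expr.val, Op.eval, State.setReg, State.setArr, Function.update_apply, reduceIte,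
        Nat.reduceEqDiff, OfNat.ofNat_ne_zero, OfNat.zero_ne_ofNat, OfNat.ofNat_ne_one,
        OfNat.one_ne_ofNat, one_ne_zero, zero_ne_one, ne_eq, not_true_eq_false, not_false_eq_true,
        forall_const, false_implies, IsEmpty.forall_iff, and_true, true_and]
      repeat refine ⟨by omega, ?_⟩
      refine h.step h0 ?_ ?_ rfl rfl ?_ ?_ ?_
      · simp
      · intro a ha
        simp [ha]
      · simp [hz]
      · simp [hz]
      · simp [hv]
    · simp only [greedyBody, h1, h2, h3, h4, h.cnt, h.gain, h.residual, h5, h10, hc, hr, hz, Cmd.wp,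
        Expr.Fits, Expr.val, Op.eval, State.setReg, State.setArr, Function.update_apply, reduceIte,
        Nat.reduceEqDiff, OfNat.ofNat_ne_zero, OfNat.zero_ne_ofNat, OfNat.ofNat_ne_one,
        OfNat.one_ne_ofNat, one_ne_zero, zero_ne_one, ne_eq, not_true_eq_false, not_false_eq_true,
        forall_const, false_implies, IsEmpty.forall_iff, and_true, true_and]
      repeat refine ⟨by omega, ?_⟩
      refine h.step h0 ?_ ?_ rfl rfl ?_ ?_ ?_
      · simp
      · intro a ha
        simp [ha]
      · simp [hz]
      · simp [hz]
      · simp [hv]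

end Ram

/-! ### The search pass, the parity correction and the running time -/

namespace Ram

local infixr:60 " ;; " => Cmd.seq

variable {n : ℕ} {S : IntervalSeq n} {W : ℕ}

theorem searchInv_of_greedyInv {σ : State} (h : GreedyInv S #S.highs σ) :
    SearchInv S 0 (σ.setReg 1 0) := by
  refine ⟨⟨?_, ?_, ?_⟩, ?_, ?_, ?_, ?_, ?_, ?_, ?_, ?_, ?_⟩
  · simpa [State.setReg] using h.len
  · simpa [State.setReg] using h.lo
  · simpa [State.setReg] using h.hi
  · simp [State.setReg]
  · simpa [State.setReg] using h.ord
  · simpa [State.setReg, IntervalSeq.lastTight] using h.tight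
  · intro j
    refine h.out j ?_
    rw [S.rank_lt_card_highs]
    exact le_or_gt _ _
  · simpa [State.setReg] using h.zeroReg 8 le_rfl (by omega)
  · simp [State.setReg, h.zeroReg 9 (by omega) (by omega)]
  · simp
  · simp [State.setReg, h.zeroReg 10 (by omega) (by omega)]
  · simp

theorem sum_rank_lt_succ (f : Fin n → ℕ) (j : Fin n) :
    ∑ i with S.rank i < S.rank j + 1, f i = ∑ i with S.rank i < S.rank j, f i + f j := by
  have : ({i | S.rank i < S.rank j + 1} : Finset (Fin n)) =
      insert j ({i | S.rank i < S.rank j} : Finset (Fin n)) := by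
    ext i
    simp only [mem_filter_univ, mem_insert, ← S.rank_injective.eq_iff]
    omega
  rw [this, sum_insert (by simp), add_comm]

theorem forall_rank_lt_succ {p : Fin n → Prop} {j : Fin n} (hj : p j)
    (h : ∀ i, S.rank i < S.rank j → p i) (i : Fin n) (hi : S.rank i < S.rank j + 1) : p i := by
  by_cases hij : i = j
  · exact hij ▸ hj
  · refine h i ?_
    have : S.rank i ≠ S.rank j := fun e => hij (S.rank_injective e)
    omega

/-- Registers 9 and 10 hold the successor of an index, so that 0 means that none was found. -/
theorem SearchInv.step {j : Fin n} {σ σ' : State} (h : SearchInv S (S.rank j) σ)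
    (h0 : σ'.reg 0 = σ.reg 0) (h1 : σ'.reg 1 = S.rank j + 1) (h7 : σ'.reg 7 = σ.reg 7)
    (ha : σ'.arr = σ.arr) (h8 : σ'.reg 8 = (σ.reg 8 + S.greedy j) % 2)
    (h9 : σ'.reg 9 = j + 1 ∧ Free S j ∨ σ'.reg 9 = σ.reg 9 ∧ ¬ Free S j)
    (h10 : σ'.reg 10 = j + 1 ∧ S.lastTight < S.greedy j ∨
      σ'.reg 10 = σ.reg 10 ∧ ¬ S.lastTight < S.greedy j) :
    SearchInv S (S.rank j + 1) σ' where
  len := h0.trans h.len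
  lo := ha ▸ h.lo
  hi := ha ▸ h.hi
  idx := h1
  ord := ha ▸ h.ord
  tight := h7.trans h.tight
  out := ha ▸ h.out
  parity := by rw [h8, sum_rank_lt_succ, h.parity, Nat.mod_add_mod]
  free := by
    obtain ⟨e, hj⟩ | ⟨e, -⟩ := h9
    · exact fun _ => ⟨j, e, hj⟩
    · exact e ▸ h.free
  not_free e' := by
    obtain ⟨e, -⟩ | ⟨e, hj⟩ := h9
    · omega
    · exact forall_rank_lt_succ hj (h.not_free (e ▸ e'))
  forced := by
    obtain ⟨e, hj⟩ | ⟨e, -⟩ := h10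
    · exact fun _ => ⟨j, e, hj⟩
    · exact e ▸ h.forced
  not_forced e' := by
    obtain ⟨e, -⟩ | ⟨e, hj⟩ := h10
    · omega
    · exact forall_rank_lt_succ hj (h.not_forced (e ▸ e'))

theorem wp_searchBody (hW : n * n + n + 2 < W) {k : ℕ} (hk : k < n) {σ : State}
    (h : SearchInv S k σ) : searchBody.wp W (SearchInv S (k + 1)) σ := by
  obtain ⟨j, rfl⟩ := S.exists_rank_eq hk
  have h1 := h.idx
  have h2 := h.lo j
  have h3 := h.hi j
  have h4 := h.ord j
  have h5 := h.tight
  have h6 := h.out j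
  have h7 := S.lo_le_hi j
  have h8 := S.hi_lt j
  have h9 := S.greedy_le_hi j
  have h10 := S.card_highs_le_card
  have h11 := S.lastTight_le
  have h12 : σ.reg 8 < 2 := by rw [h.parity]; exact Nat.mod_lt _ (by omega)
  have hj := j.2
  have hmod := Nat.mod_lt (σ.reg 8 + S.greedy j) (by omega : 2 > 0)
  by_cases hf : S.lastTight < S.greedy j
  · by_cases c1 : S.rank j < S.lastTight
    · simp only [searchBody, h1, h2, h3, h4, h5, h6, hf, c1, Cmd.wp, Expr.Fits, Expr.val, Op.eval,
        State.setReg, State.setArr, Function.update_apply, reduceIte, Nat.reduceEqDiff,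
        OfNat.ofNat_ne_zero, OfNat.zero_ne_ofNat, OfNat.ofNat_ne_one, OfNat.one_ne_ofNat,
        one_ne_zero, zero_ne_one, ne_eq, not_true_eq_false, not_false_eq_true, forall_const,
        false_implies, IsEmpty.forall_iff, and_true, true_and]
      repeat refine ⟨by omega, ?_⟩
      exact h.step rfl rfl rfl rfl rfl (.inr ⟨rfl, fun hh => by have := hh.1; omega⟩)
        (.inl ⟨rfl, hf⟩)
    by_cases c2 : S.lo j < S.hi j
    swap
    · simp only [searchBody, h1, h2, h3, h4, h5, h6, hf, c1, c2, Cmd.wp, Expr.Fits, Expr.val,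
        Op.eval, State.setReg, State.setArr, Function.update_apply, reduceIte, Nat.reduceEqDiff,
        OfNat.ofNat_ne_zero, OfNat.zero_ne_ofNat, OfNat.ofNat_ne_one, OfNat.one_ne_ofNat,
        one_ne_zero, zero_ne_one, ne_eq, not_true_eq_false, not_false_eq_true, forall_const,
        false_implies, IsEmpty.forall_iff, and_true, true_and]
      repeat refine ⟨by omega, ?_⟩
      exact h.step rfl rfl rfl rfl rfl (.inr ⟨rfl, fun hh => c2 hh.2.1⟩) (.inl ⟨rfl, hf⟩)
    have c3 : S.lastTight < S.hi j := hf.trans_le h9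
    simp only [searchBody, h1, h2, h3, h4, h5, h6, hf, c1, c2, c3, Cmd.wp, Expr.Fits, Expr.val,
      Op.eval, State.setReg, State.setArr, Function.update_apply, reduceIte, Nat.reduceEqDiff,
      OfNat.ofNat_ne_zero, OfNat.zero_ne_ofNat, OfNat.ofNat_ne_one, OfNat.one_ne_ofNat, one_ne_zero,
      zero_ne_one, ne_eq, not_true_eq_false, not_false_eq_true, forall_const, false_implies,
      IsEmpty.forall_iff, and_true, true_and]
    repeat refine ⟨by omega, ?_⟩
    exact h.step rfl rfl rfl rfl rfl (.inl ⟨rfl, not_lt.1 c1, c2, c3⟩) (.inl ⟨rfl, hf⟩)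
  · by_cases c1 : S.rank j < S.lastTight
    · simp only [searchBody, h1, h2, h3, h4, h5, h6, hf, c1, Cmd.wp, Expr.Fits, Expr.val, Op.eval,
        State.setReg, State.setArr, Function.update_apply, reduceIte, Nat.reduceEqDiff,
        OfNat.ofNat_ne_zero, OfNat.zero_ne_ofNat, OfNat.ofNat_ne_one, OfNat.one_ne_ofNat,
        one_ne_zero, zero_ne_one, ne_eq, not_true_eq_false, not_false_eq_true, forall_const,
        false_implies, IsEmpty.forall_iff, and_true, true_and]
      repeat refine ⟨by omega, ?_⟩
      exact h.step rfl rfl rfl rfl rfl (.inr ⟨rfl, fun hh => by have := hh.1; omega⟩)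
        (.inr ⟨rfl, hf⟩)
    by_cases c2 : S.lo j < S.hi j
    swap
    · simp only [searchBody, h1, h2, h3, h4, h5, h6, hf, c1, c2, Cmd.wp, Expr.Fits, Expr.val,
        Op.eval, State.setReg, State.setArr, Function.update_apply, reduceIte, Nat.reduceEqDiff,
        OfNat.ofNat_ne_zero, OfNat.zero_ne_ofNat, OfNat.ofNat_ne_one, OfNat.one_ne_ofNat,
        one_ne_zero, zero_ne_one, ne_eq, not_true_eq_false, not_false_eq_true, forall_const,
        false_implies, IsEmpty.forall_iff, and_true, true_and]
      repeat refine ⟨by omega, ?_⟩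
      exact h.step rfl rfl rfl rfl rfl (.inr ⟨rfl, fun hh => c2 hh.2.1⟩) (.inr ⟨rfl, hf⟩)
    by_cases c3 : S.lastTight < S.hi j
    · simp only [searchBody, h1, h2, h3, h4, h5, h6, hf, c1, c2, c3, Cmd.wp, Expr.Fits, Expr.val,
        Op.eval, State.setReg, State.setArr, Function.update_apply, reduceIte, Nat.reduceEqDiff,
        OfNat.ofNat_ne_zero, OfNat.zero_ne_ofNat, OfNat.ofNat_ne_one, OfNat.one_ne_ofNat,
        one_ne_zero, zero_ne_one, ne_eq, not_true_eq_false, not_false_eq_true, forall_const,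
        false_implies, IsEmpty.forall_iff, and_true, true_and]
      repeat refine ⟨by omega, ?_⟩
      exact h.step rfl rfl rfl rfl rfl (.inl ⟨rfl, not_lt.1 c1, c2, c3⟩) (.inr ⟨rfl, hf⟩)
    · simp only [searchBody, h1, h2, h3, h4, h5, h6, hf, c1, c2, c3, Cmd.wp, Expr.Fits, Expr.val,
        Op.eval, State.setReg, State.setArr, Function.update_apply, reduceIte, Nat.reduceEqDiff,
        OfNat.ofNat_ne_zero, OfNat.zero_ne_ofNat, OfNat.ofNat_ne_one, OfNat.one_ne_ofNat,
        one_ne_zero, zero_ne_one, ne_eq, not_true_eq_false, not_false_eq_true, forall_const,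
        false_implies, IsEmpty.forall_iff, and_true, true_and]
      repeat refine ⟨by omega, ?_⟩
      exact h.step rfl rfl rfl rfl rfl (.inr ⟨rfl, fun hh => c3 hh.2.2⟩) (.inr ⟨rfl, hf⟩)

theorem wp_correct [NeZero n] (hW : n * n + n + 2 < W) {σ : State} (h : SearchInv S n σ) :
    correct.wp W (fun σ' => S.IsMinDeviation (output n σ')) σ := by
  have hout : output n σ = S.greedy := funext h.out
  have hpar : σ.reg 8 = (∑ j, S.greedy j) % 2 := by
    rw [h.parity]
    congr 2
    exact filter_true_of_mem fun i _ => S.rank_lt i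
  have hupd : ∀ (j : Fin n) (v : ℕ) (ρ : ℕ → ℕ),
      output n ⟨ρ, Function.update σ.arr 2 (Function.update (σ.arr 2) j v)⟩ =
        Function.update S.greedy j v := by
    intro j v ρ
    funext i
    simp only [output, Function.update_apply, reduceIte, h.out, Fin.ext_iff]
  by_cases h8 : σ.reg 8 = 0
  · simp only [correct, h8, Cmd.wp, Expr.Fits, Expr.val, Op.eval, State.setReg, State.setArr,
      Function.update_apply, reduceIte, Nat.reduceEqDiff, OfNat.ofNat_ne_zero, OfNat.zero_ne_ofNat,
      OfNat.ofNat_ne_one, OfNat.one_ne_ofNat, one_ne_zero, zero_ne_one, ne_eq, not_true_eq_false,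
      not_false_eq_true, forall_const, false_implies, IsEmpty.forall_iff, and_true, true_and]
    refine ⟨by omega, ?_⟩
    rw [hout]
    exact S.isMinDeviation_greedy (Nat.even_iff.2 (by omega))
  have hodd : ¬ Even (∑ j, S.greedy j) := by rw [Nat.even_iff]; omega
  by_cases h9 : σ.reg 9 = 0
  · have hf := h.not_free h9
    -- An odd sum guarantees an entry above `lastTight`, so the search has found one.
    have h10 : σ.reg 10 ≠ 0 := fun e => by
      obtain ⟨i, hi⟩ := S.exists_lastTight_lt hodd
      exact h.not_forced e i (S.rank_lt i) hi
    obtain ⟨j, e, hj⟩ := h.forced h10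
    have h1 := S.greedy_le_hi j
    have h2 := S.hi_lt j
    have hj' := j.2
    have h3 := h.out j
    simp only [correct, h8, h9, e, h3, Nat.add_sub_cancel, hupd, Cmd.wp, Expr.Fits, Expr.val,
      Op.eval, State.setReg, State.setArr, Function.update_apply, reduceIte, Nat.reduceEqDiff,
      OfNat.ofNat_ne_zero, OfNat.zero_ne_ofNat, OfNat.ofNat_ne_one, OfNat.one_ne_ofNat, one_ne_zero,
      zero_ne_one, ne_eq, not_true_eq_false, not_false_eq_true, forall_const, false_implies,
      IsEmpty.forall_iff, and_true, true_and]
    refine ⟨by omega, by omega, by omega, by omega, by omega, ?_⟩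
    exact S.isMinDeviation_of_forced hodd (fun i h4 h5 => by
      have := hf i (S.rank_lt i)
      simp only [Free, not_and, not_lt] at this
      exact this h4 h5) hj
  · obtain ⟨j, e, hj⟩ := h.free h9
    have h1 := S.greedy_le_hi j
    have h2 := S.hi_lt j
    have hj' := j.2
    have h3 := h.out j
    have h4 := h.hi j
    have key := S.isMinDeviation_of_free hodd hj.1 hj.2.1 hj.2.2
    have e0 : (j : ℕ) + 1 ≠ 0 := by omega
    by_cases hc : S.greedy j < S.hi j
    · rw [if_pos hc] at key
      simp only [correct, h8, e, e0, h3, h4, hc, Nat.add_sub_cancel, hupd, Cmd.wp, Expr.Fits,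
        Expr.val, Op.eval, State.setReg, State.setArr, Function.update_apply, reduceIte,
        Nat.reduceEqDiff, OfNat.ofNat_ne_zero, OfNat.zero_ne_ofNat, OfNat.ofNat_ne_one,
        OfNat.one_ne_ofNat, one_ne_zero, zero_ne_one, ne_eq, not_true_eq_false, not_false_eq_true,
        forall_const, false_implies, IsEmpty.forall_iff, and_true, true_and]
      repeat refine ⟨by omega, ?_⟩
      exact key
    · rw [if_neg hc] at key
      simp only [correct, h8, e, e0, h3, h4, hc, Nat.add_sub_cancel, hupd, Cmd.wp, Expr.Fits,
        Expr.val, Op.eval, State.setReg, State.setArr, Function.update_apply, reduceIte,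
        Nat.reduceEqDiff, OfNat.ofNat_ne_zero, OfNat.zero_ne_ofNat, OfNat.ofNat_ne_one,
        OfNat.one_ne_ofNat, one_ne_zero, zero_ne_one, ne_eq, not_true_eq_false, not_false_eq_true,
        forall_const, false_implies, IsEmpty.forall_iff, and_true, true_and]
      repeat refine ⟨by omega, ?_⟩
      exact key

/-- The time constant of the program. -/
def timeFactor : ℕ :=
  countBody.timeBound + levelBody.timeBound + sortBody.timeBound + greedyBody.timeBound +
    searchBody.timeBound + correct.timeBound + 100

theorem halts_minDeviation [NeZero n] (S : IntervalSeq n) (hW : n * n + n + 2 < W) :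
    Halts W minDeviation (timeFactor * n) (fun σ => S.IsMinDeviation (output n σ))
      (inputState S) := by
  have hn : 0 < n := Nat.pos_of_ne_zero (NeZero.ne n)
  have hreset : ∀ σ, reset.wp W (fun σ' => σ' = σ.setReg 1 0) σ := fun σ => by
    simp [reset, Cmd.wp, Expr.Fits, Expr.val]
    omega
  have hlen : ∀ k σ, Input S σ → σ.reg 1 = k → σ.reg 1 = k ∧ σ.reg 0 = n :=
    fun k σ h h' => ⟨h', h.len⟩
  have hrun : Halts W minDeviation
      ((n * (countBody.timeBound + 4) + 4) + (reset.timeBound +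
      ((n * (levelBody.timeBound + 4) + 4) + (reset.timeBound +
      ((n * (sortBody.timeBound + 4) + 4) +
      ((reset ;; .assign 12 (.op .sub (.reg 0) (.reg 5))).timeBound +
      ((#S.highs * (greedyBody.timeBound + 4) + 4) + (reset.timeBound +
      ((n * (searchBody.timeBound + 4) + 4) + correct.timeBound)))))))))
      (fun σ => S.IsMinDeviation (output n σ)) (inputState S) := by
    refine (Halts.upTo (CountInv S) (by omega) (by omega)
      (fun k σ h => hlen k σ h.toInput h.idx) (fun k hk σ => wp_countBody hW hk)
      countInv_input).seq fun σ₁ h₁ => ?_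
    refine (Halts.of_wp (hreset σ₁)).seq ?_
    rintro _ rfl
    refine (Halts.upTo (LevelInv S) (by omega) (by omega)
      (fun k σ h => hlen k σ h.toInput h.idx) (fun k hk σ => wp_levelBody hW hk)
      (levelInv_of_countInv hn h₁)).seq fun σ₂ h₂ => ?_
    refine (Halts.of_wp (hreset σ₂)).seq ?_
    rintro _ rfl
    refine (Halts.upTo (SortInv S) (by omega) (by omega)
      (fun k σ h => hlen k σ h.toInput h.idx) (fun k hk σ => wp_sortBody hW hk)
      (sortInv_of_levelInv h₂)).seq fun σ₃ h₃ => ?_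
    have h₄ : (reset ;; Cmd.assign 12 (.op .sub (.reg 0) (.reg 5))).wp W
        (fun σ => σ = (σ₃.setReg 1 0).setReg 12 (n - σ₃.reg 5)) σ₃ := by
      have h5 : σ₃.reg 5 ≤ n := by rw [h₃.highs]; exact card_filter_le _
      have h0 := h₃.len
      simp only [h0, Cmd.wp, Expr.Fits, Expr.val, Op.eval, State.setReg, State.setArr,
        Function.update_apply, reduceIte, Nat.reduceEqDiff, OfNat.ofNat_ne_zero,
        OfNat.zero_ne_ofNat, OfNat.ofNat_ne_one, OfNat.one_ne_ofNat, one_ne_zero, zero_ne_one,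
        ne_eq, not_true_eq_false, not_false_eq_true, forall_const, false_implies,
        IsEmpty.forall_iff, and_true, true_and]
      omega
    refine (Halts.of_wp h₄).seq ?_
    rintro _ rfl
    have hm := S.card_highs_le_card
    refine (Halts.upTo (GreedyInv S) (by omega) (by omega)
      (fun k σ h => ⟨h.idx, h.highs⟩) (fun k hk σ => wp_greedyBody hW hk)
      (greedyInv_of_sortInv h₃)).seq fun σ₅ h₅ => ?_
    refine (Halts.of_wp (hreset σ₅)).seq ?_
    rintro _ rfl
    refine (Halts.upTo (SearchInv S) (by omega) (by omega)
      (fun k σ h => hlen k σ h.toInput h.idx) (fun k hk σ => wp_searchBody hW hk)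
      (searchInv_of_greedyInv h₅)).seq fun σ₆ h₆ => ?_
    exact Halts.of_wp (wp_correct hW h₆)
  obtain ⟨t, σ, he, ht, hσ⟩ := hrun
  refine ⟨t, σ, he, ht.trans ?_, hσ⟩
  have hm : #S.highs * (greedyBody.timeBound + 4) ≤ n * (greedyBody.timeBound + 4) :=
    Nat.mul_le_mul_right _ S.card_highs_le_card
  have hc : correct.timeBound ≤ correct.timeBound * n := Nat.le_mul_of_pos_right _ hn
  -- As n ≥ 1, the summand 100 · n absorbs the additive constants of the loops and resets.
  simp only [timeFactor, add_mul, mul_add, mul_comm n] at hm ⊢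
  simp only [reset, Cmd.timeBound, Expr.cost] at *
  omega

theorem sq_add_lt_two_pow (n : ℕ) (hn : 1 ≤ n) : n * n + n + 2 < 2 ^ (3 * (Nat.log 2 n + 1)) := by
  have h : n + 1 ≤ 2 ^ (Nat.log 2 n + 1) := Nat.lt_pow_succ_log_self (by omega) n
  have h3 : (n + 1) ^ 3 ≤ 2 ^ (3 * (Nat.log 2 n + 1)) := by
    rw [mul_comm, pow_mul]
    exact Nat.pow_le_pow_left h 3
  nlinarith

end Ram

/-- Removes the case n = 1, where n log n vanishes; for n ≥ 2 the logarithm is at least 1 and the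
linear bound suffices. -/
theorem IntervalSeq.realizable_of_length_one (S : IntervalSeq 1) : S.Realizable := by
  refine ⟨fun _ => 0, ⟨⊥, inferInstance, fun i => by simp⟩, fun i => ?_⟩
  have := S.hi_lt i
  have := S.lo_le_hi i
  exact ⟨by omega, Nat.zero_le _⟩

/-- One fixed program computes, for every non-realizable interval sequence of length `n`, a graphic
sequence of minimum deviation in time `O(n log n)` on a machine with words of `O(log n)` bits. -/
theorem theorem2 :
    ∃ (P : Ram.Cmd) (c C : ℕ), ∀ (n : ℕ), 1 ≤ n → ∀ (S : IntervalSeq n), ¬ S.Realizable →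
      ∃ (t : ℕ) (σ : Ram.State),
        Ram.Exec (2 ^ (c * (Nat.log 2 n + 1))) P (Ram.inputState S) t σ ∧
        t ≤ C * (n * Nat.log 2 n) ∧
        S.IsMinDeviation (Ram.output n σ) := by
  refine ⟨Ram.minDeviation, 3, Ram.timeFactor, fun n hn S hS => ?_⟩
  have : NeZero n := ⟨by omega⟩
  obtain ⟨t, σ, he, ht, hσ⟩ := Ram.halts_minDeviation S (Ram.sq_add_lt_two_pow n hn)
  refine ⟨t, σ, he, ht.trans (Nat.mul_le_mul_left _ (Nat.le_mul_of_pos_right _ ?_)), hσ⟩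
  refine Nat.log_pos (by omega) ?_
  by_contra h
  obtain rfl : n = 1 := by omega
  exact hS S.realizable_of_length_one
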